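/- Let $d\ge 2$, $P=-i\nabla$, and write $\mathbb 1_{\ge R}$ for the characteristic function of $\{x\in\mathbb R^d:|x|\ge R\}$. Definitions. For a real vector field $A\in L^2_{\rm loc}(\mathbb R^d,\mathbb R^d)$ let $\mathcal D(P-A)=\{\varphi\in L^2(\mathbb R^d):(P-A)\varphi\in L^2\}$ (in the sense of distributions). A potential is a real-valued function $W\in L^1_{\rm loc}(\mathbb R^d)$, with form domain $\mathcal Q(W)=\mathcal D(|W|^{1/2})$ and quadratic form $\langle\varphi,W\varphi\rangle=\int W|\varphi|^2\,dx$. It *vanishes at infinity with respect to $(P-A)^2$* if for some $R_0>0$ every $\varphi\in\mathcal D(P-A)$ with $\operatorname{supp}\varphi\subset\{|x|\ge R_0\}$ lies in $\mathcal Q(W)$, and for $R\ge R_0$ there are $\alpha_R,\gamma_R>0$ with $\alpha_R,\gamma_R\to0$ as $R\to\infty$ such that $$|\langle\varphi,W\varphi\rangle|\le\alpha_R\|(P-A)\varphi\|_2^2+\gamma_R\|\varphi\|_2^2\quad\text{for all }\varphi\in\mathcal D(P-A)\text{ with }\operatorname{supp}\varphi\subset\{|x|\ge R\}.$$ A real distribution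 $V$ *vanishes at infinity with respect to $(P-A)^2$* if for some $R_0>0$ the form $\varphi\mapsto\langle\varphi,V\varphi\rangle:=V(|\varphi|^2)$ on complex $\varphi\in C_0^\infty(\mathbb R^d)$ with support in $\{|x|\ge R_0\}$ has an extension to all $\varphi\in\mathcal D(P-A)$ with support in $\{|x|\ge R_0\}$ which is continuous in the norm $(\|(P-A)\varphi\|_2^2+\|\varphi\|_2^2)^{1/2}$ and satisfies the same bounds. A measurable real-valued $W$ is in the Kato class $K_d$ if $\lim_{\alpha\to0+}\sup_{x}\int_{|x-y|\le\alpha}g_d(x-y)|W(y)|\,dy=0$, where $g_d(x)=|x|^{2-d}$ for $d\ge3$ and $g_2(x)=|\ln|x||$; it is in the Kato class outside a compact set if $\mathbb 1_{K^c}W\in K_d$ for some compact $K\subset\mathbb R^d$. Finally $\|W\|_{L^1_{\rm loc,unif}}=\sup_x\int_{|x-y|\le1}|W(y)|\,dy$. Proposition. (i) If a potential $W$ is in the Kato class outside a compact set and $\lim_{R\to\infty}\|\mathbb 1_{\ge R}W\|_{L^1_{\rm loc,unif}}=0$, then $W$ vanishes at infinity with respect to $P^2$, and also with respect to $(P-A)^2$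 for every $A\in L^2_{\rm loc}(\mathbb R^d,\mathbb R^d)$. (ii) If $V=\nabla\cdot\Sigma+W$ in the sense of distributions, with a real vector field $\Sigma\in L^2_{\rm loc}(\mathbb R^d,\mathbb R^d)$ and a potential $W\in L^1_{\rm loc}(\mathbb R^d)$ such that both $\Sigma^2=|\Sigma|^2$ and $W$ are in the Kato class outside a compact set and satisfy $\lim_{R\to\infty}\|\mathbb 1_{\ge R}\Sigma^2\|_{L^1_{\rm loc,unif}}=\lim_{R\to\infty}\|\mathbb 1_{\ge R}W\|_{L^1_{\rm loc,unif}}=0$, then $V$ vanishes at infinity with respect to $P^2$, and also with respect to $(P-A)^2$ for every $A\in L^2_{\rm loc}(\mathbb R^d,\mathbb R^d)$. -/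

import Mathlib

open MeasureTheory Filter Topology TopologicalSpace
open scoped ENNReal Distributions LineDeriv

noncomputable section

namespace KatoVanishing

/-- The Euclidean space `ℝ^d`. -/
abbrev Space (d : ℕ) : Type := EuclideanSpace ℝ (Fin d)

/-- The `j`-th standard basis vector of `ℝ^d`. -/
def basisVec {d : ℕ} (j : Fin d) : Space d := EuclideanSpace.single j (1 : ℝ)

/-- The space `L²_loc(ℝ^d, ℝ^d)` of locally square integrable real vector fields. -/
def LocL2 {d : ℕ} (A : Space d → Space d) : Prop :=
  ∀ K : Set (Space d), IsCompact K → MemLp A 2 (volume.restrict K)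

/-- `‖f‖₂²`. -/
def l2NormSq {d : ℕ} {F : Type*} [NormedAddCommGroup F] (f : Space d → F) : ℝ :=
  ∫ x, ‖f x‖ ^ 2

/-- `φ ∈ 𝒟(P - A)` and `v = (P - A) φ`, where `P = -i∇`: both `φ` and `v` are square integrable,
and `-i ∂_j φ - A_j φ = v_j` in the sense of distributions for every `j`. -/
structure HasMagneticMomentum {d : ℕ} (A : Space d → Space d) (φ : Space d → ℂ)
    (v : Space d → EuclideanSpace ℂ (Fin d)) : Prop where
  memLp_fun : MemLp φ 2 volume
  memLp_momentum : MemLp v 2 volume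
  weak_eq : ∀ (ψ : 𝓓((⊤ : Opens (Space d)), ℂ)) (j : Fin d),
    ∫ x, φ x * (Complex.I * fderiv ℝ ψ x (basisVec j) - ((A x j : ℝ) : ℂ) * ψ x)
      = ∫ x, v x j * ψ x

/-- The (essential) support of `φ` is contained in `{x : ‖x‖ ≥ R}`. -/
def SuppOutside {d : ℕ} (R : ℝ) (φ : Space d → ℂ) : Prop :=
  ∀ᵐ x : Space d, ‖x‖ < R → φ x = 0

/-- The quadratic form `⟨φ, W φ⟩ = ∫ W |φ|²` of a potential `W`. -/
def potentialForm {d : ℕ} (W : Space d → ℝ) (φ : Space d → ℂ) : ℝ :=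
  ∫ x, W x * ‖φ x‖ ^ 2

/-- The quadratic form domain `𝒬(W) = 𝒟(|W|^{1/2})` of a potential `W`. -/
def InFormDomain {d : ℕ} (W : Space d → ℝ) (φ : Space d → ℂ) : Prop :=
  MemLp φ 2 volume ∧ MemLp (fun x => ((√|W x| : ℝ) : ℂ) * φ x) 2 volume

/-- For all `R ≥ R₀` there are positive `α_R, γ_R`, tending to `0` as `R → ∞`, such that
`|q(φ)| ≤ α_R ‖(P - A) φ‖₂² + γ_R ‖φ‖₂²` for all `φ ∈ 𝒟(P - A)` supported in
`{x : ‖x‖ ≥ R}`. -/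
def FormVanishesBeyond {d : ℕ} (A : Space d → Space d) (q : (Space d → ℂ) → ℝ) (R₀ : ℝ) : Prop :=
  ∃ α γ : ℝ → ℝ,
    (∀ R, R₀ ≤ R → 0 < α R ∧ 0 < γ R) ∧
    Tendsto α atTop (𝓝 0) ∧ Tendsto γ atTop (𝓝 0) ∧
    ∀ R, R₀ ≤ R → ∀ φ v, HasMagneticMomentum A φ v → SuppOutside R φ →
      |q φ| ≤ α R * l2NormSq v + γ R * l2NormSq φ

/-- The potential `W` vanishes at infinity with respect to `(P - A)²`. -/
def VanishesAtInfinity {d : ℕ} (A : Space d → Space d) (W : Space d → ℝ) : Prop :=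
  ∃ R₀ : ℝ, 0 < R₀ ∧
    (∀ φ v, HasMagneticMomentum A φ v → SuppOutside R₀ φ → InFormDomain W φ) ∧
    FormVanishesBeyond A (potentialForm W) R₀

/-- The real test function `|φ|²` for a complex test function `φ`. -/
def absSq {d : ℕ} (φ : 𝓓((⊤ : Opens (Space d)), ℂ)) : 𝓓((⊤ : Opens (Space d)), ℝ) where
  toFun x := ‖φ x‖ ^ 2
  contDiff' := φ.contDiff.norm_sq ℝ
  hasCompactSupport' :=
    φ.hasCompactSupport.comp_left (g := fun z : ℂ => ‖z‖ ^ 2) (by simp)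
  tsupport_subset' := fun _ _ => trivial

/-- A real distribution `V` vanishes at infinity with respect to `(P - A)²`: for some `R₀ > 0` its
quadratic form `φ ↦ V(|φ|²)` on test functions supported in `{x : ‖x‖ ≥ R₀}` has an extension `q`
to all `φ ∈ 𝒟(P - A)` supported there which is continuous in the graph norm of `P - A`, and `q`
satisfies the same bounds as in the case of a potential. -/
def DistributionVanishesAtInfinity {d : ℕ} (A : Space d → Space d)
    (V : 𝓓'((⊤ : Opens (Space d)), ℝ)) : Prop :=
  ∃ R₀ : ℝ, 0 < R₀ ∧ ∃ q : (Space d → ℂ) → ℝ,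
    (∀ φ : 𝓓((⊤ : Opens (Space d)), ℂ), SuppOutside R₀ φ → q φ = V (absSq φ)) ∧
    (∀ φ v, ∀ (φs : ℕ → Space d → ℂ) (vs : ℕ → Space d → EuclideanSpace ℂ (Fin d)),
      HasMagneticMomentum A φ v → SuppOutside R₀ φ →
      (∀ n, HasMagneticMomentum A (φs n) (vs n)) → (∀ n, SuppOutside R₀ (φs n)) →
      Tendsto (fun n => l2NormSq (φs n - φ)) atTop (𝓝 0) →
      Tendsto (fun n => l2NormSq (vs n - v)) atTop (𝓝 0) →
      Tendsto (fun n => q (φs n)) atTop (𝓝 (q φ))) ∧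
    FormVanishesBeyond A q R₀

/-- The distribution `ψ ↦ ∫ f ψ` given by a locally integrable function `f`. -/
def distOf {d : ℕ} (f : Space d → ℝ) : 𝓓'((⊤ : Opens (Space d)), ℝ) :=
  TestFunction.integralAgainstBilinCLM (ContinuousLinearMap.mul ℝ ℝ) volume f

/-- The distributional divergence `∇·S = ∑ j, ∂_j S_j` of a locally integrable vector field. -/
def distDiv {d : ℕ} (S : Space d → Space d) : 𝓓'((⊤ : Opens (Space d)), ℝ) :=
  ∑ j : Fin d, ∂_{basisVec j} (distOf fun x => S x j)

/-- The kernel `g_d` as a function of `r = |x|`: `r^{2-d}` for `d ≥ 3`, and `|log r|` for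
`d = 2` (other `d` are not used). -/
def katoKernel (d : ℕ) (r : ℝ) : ℝ :=
  if d = 2 then |Real.log r| else r ^ (2 - (d : ℤ))

/-- The Kato class `K_d`, for `d ≥ 2`. -/
def KatoClass {d : ℕ} (W : Space d → ℝ) : Prop :=
  AEStronglyMeasurable W volume ∧
  Tendsto (fun a : ℝ => ⨆ x : Space d, ∫⁻ y in Metric.closedBall x a,
      ENNReal.ofReal (katoKernel d ‖x - y‖) * ‖W y‖ₑ) (𝓝[>] 0) (𝓝 0)

/-- `W` is in the Kato class outside a compact set. -/
def KatoClassOutsideCompact {d : ℕ} (W : Space d → ℝ) : Prop :=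
  ∃ K : Set (Space d), IsCompact K ∧ KatoClass (Kᶜ.indicator W)

/-- The norm of `L¹_{loc,unif}`, with values in `[0, ∞]`. -/
def l1LocUnifNorm {d : ℕ} (W : Space d → ℝ) : ℝ≥0∞ :=
  ⨆ x : Space d, ∫⁻ y in Metric.closedBall x 1, ‖W y‖ₑ

/-- `W` vanishes at infinity locally uniformly in `L¹`. -/
def VanishesLocUnifL1 {d : ℕ} (W : Space d → ℝ) : Prop :=
  Tendsto (fun R : ℝ => l1LocUnifNorm ({x : Space d | R ≤ ‖x‖}.indicator W)) atTop (𝓝 0)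

end KatoVanishing

end

/-! ### Mollification and weak derivatives -/

namespace KatoVanishing
open scoped Convolution ContDiff

/-! Everything rests on one form bound, `exists_lintegral_mul_normSq_le`: if `W ≥ 0` satisfies the
Kato bound with constant `κ`, then `∫ W|φ|² ≤ C κ (‖(P - A)φ‖² + ‖φ‖²)`, where `C` depends on `d`
only. Smallness of the Kato integral over small balls, combined with the decay in uniform local `L¹`
on the remaining shell, makes the Kato bound of `𝟙_{≥R} W` tend to `0` (`tendsto_katoBound`). Part
(i) follows.

The form bound comes from a ground state representation. For a bounded real `C¹` field `F` with
bounded `∂_j F_j`, expanding `0 ≤ ‖(P - A)φ + iFφ‖²` and integrating by parts gives `∫ (-div F -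
|F|²)|φ|² ≤ ‖(P - A)φ‖²`. The field `A` drops out because `∂_j|φ|² = -2 Im(conj φ ((P - A)φ)_j)`, so
no diamagnetic inequality is needed. For `F = ∇w/w` the potential on the left is `-Δw/w`. Take `w =
κ + N_δ ⋆ W`, with `N_δ` a regularized and truncated Newtonian kernel. The Kato bound gives `κ ≤ w ≤
2κ`, while `-ΔN_δ ≥ c δ^{-d} 𝟙_{|x| ≤ δ} - 4M g_d`. Hence the average of `W` over the `δ`-ball is at
most a constant times `κ (-Δw/w + 4M)`, and `δ → 0` with Lebesgue differentiation and Fatou yields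
the claim.

Since `A` is only in `L²_loc`, `∇φ` is only known to be in `L¹_loc`. The formula for `∂_j|φ|²` is
therefore proved by mollification, through a chain rule for bounded `C¹` functions with bounded
derivative, and a limit.

For (ii), the form of `∇·Σ` is rewritten as `2 ∫ Im(conj φ (P - A)φ)·Σ`. This makes sense on the
whole domain far out because `Σ²` obeys the bound of (i), and Cauchy–Schwarz with weight `√β`, where
`β` is the form bound of `Σ²`, makes both coefficients small. -/

theorem tendsto_lintegral_zero_of_le_of_tendsto {α : Type*} [MeasurableSpace α] {μ : Measure α}
    {h G : ℕ → α → ℝ≥0∞} {G' : α → ℝ≥0∞} (hh : ∀ n, AEMeasurable (h n) μ)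
    (hG : ∀ n, AEMeasurable (G n) μ) (hle : ∀ n x, h n x ≤ G n x)
    (hlim : ∀ᵐ x ∂μ, Tendsto (fun n => h n x) atTop (𝓝 0))
    (hGlim : ∀ᵐ x ∂μ, Tendsto (fun n => G n x) atTop (𝓝 (G' x)))
    (hint : ∀ n, ∫⁻ x, G n x ∂μ = ∫⁻ x, G' x ∂μ) (hfin : ∫⁻ x, G' x ∂μ ≠ ⊤) :
    Tendsto (fun n => ∫⁻ x, h n x ∂μ) atTop (𝓝 0) := by
  have hsum : ∀ n, ∫⁻ x, h n x ∂μ + ∫⁻ x, (G n x - h n x) ∂μ = ∫⁻ x, G' x ∂μ := by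
    intro n
    rw [← lintegral_add_left' (hh n), ← hint n]
    exact lintegral_congr fun x => add_tsub_cancel_of_le (hle n x)
  -- Generalized dominated convergence: the majorant varies with `n` but its integral does not, so
  -- Fatou is applied to `G n - h n`.
  have hfat : ∫⁻ x, G' x ∂μ ≤ liminf (fun n => ∫⁻ x, (G n x - h n x) ∂μ) atTop := by
    refine le_trans (le_of_eq ?_) (lintegral_liminf_le' fun n => (hG n).sub (hh n))
    refine lintegral_congr_ae ?_
    filter_upwards [hlim, hGlim] with x h1 h2
    have := ENNReal.Tendsto.sub h2 h1 (Or.inr ENNReal.zero_ne_top)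
    rw [tsub_zero] at this
    exact this.liminf_eq.symm
  have hle' : ∀ n, ∫⁻ x, (G n x - h n x) ∂μ ≤ ∫⁻ x, G' x ∂μ := fun n =>
    (hsum n) ▸ le_add_self
  have hy : Tendsto (fun n => ∫⁻ x, (G n x - h n x) ∂μ) atTop (𝓝 (∫⁻ x, G' x ∂μ)) := by
    refine tendsto_of_le_liminf_of_limsup_le hfat ?_
    exact limsup_le_of_le (by isBoundedDefault) (Eventually.of_forall hle')
  have h0 : Tendsto (fun n => ∫⁻ x, G' x ∂μ - ∫⁻ x, (G n x - h n x) ∂μ) atTop (𝓝 0) := by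
    have := ENNReal.Tendsto.sub (tendsto_const_nhds (x := ∫⁻ x, G' x ∂μ)) hy (Or.inl hfin)
    rwa [tsub_self] at this
  refine h0.congr fun n => ?_
  rw [← hsum n]
  exact ENNReal.add_sub_cancel_right ((hle' n).trans_lt hfin.lt_top).ne

/-- A sequence of smooth bump functions shrinking to the origin. -/
noncomputable def shrinkingBump {E : Type*} [NormedAddCommGroup E] (n : ℕ) :
    ContDiffBump (0 : E) where
  rIn := 1 / (2 * ((n : ℝ) + 1))
  rOut := 1 / ((n : ℝ) + 1)
  rIn_pos := by positivity
  rIn_lt_rOut := by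
    apply one_div_lt_one_div_of_lt <;> [positivity; linarith [(n.cast_nonneg : (0 : ℝ) ≤ n)]]

theorem shrinkingBump_rOut_tendsto {E : Type*} [NormedAddCommGroup E] :
    Tendsto (fun n => (shrinkingBump (E := E) n).rOut) atTop (𝓝 0) :=
  tendsto_one_div_add_atTop_nhds_zero_nat

/-- Comparable inner and outer radii are what almost everywhere convergence of the mollifications at
Lebesgue points requires. -/
theorem shrinkingBump_rOut_le {E : Type*} [NormedAddCommGroup E] (n : ℕ) :
    (shrinkingBump (E := E) n).rOut ≤ 2 * (shrinkingBump (E := E) n).rIn := by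
  simp only [shrinkingBump]
  apply le_of_eq
  field_simp

/-- The mollification of a locally integrable function. -/
noncomputable def mollify {d : ℕ} {F : Type*} [NormedAddCommGroup F] [NormedSpace ℝ F]
    (n : ℕ) (g : Space d → F) : Space d → F :=
  (shrinkingBump n).normed volume ⋆[ContinuousLinearMap.lsmul ℝ ℝ, volume] g

section

variable {d : ℕ} {F : Type*} [NormedAddCommGroup F] [NormedSpace ℝ F]

theorem ae_tendsto_mollify [CompleteSpace F] {g : Space d → F} (hg : LocallyIntegrable g volume) :
    ∀ᵐ x, Tendsto (fun n => mollify n g x) atTop (𝓝 (g x)) :=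
  ContDiffBump.ae_convolution_tendsto_right_of_locallyIntegrable (K := 2)
    shrinkingBump_rOut_tendsto (Eventually.of_forall shrinkingBump_rOut_le) hg

theorem contDiff_mollify {g : Space d → F} (hg : LocallyIntegrable g volume) (n : ℕ) :
    ContDiff ℝ ∞ (mollify n g) :=
  (shrinkingBump n).hasCompactSupport_normed.contDiff_convolution_left _
    (n := ⊤) ((shrinkingBump n).contDiff_normed) hg

theorem norm_mollify_le {g : Space d → F} (n : ℕ) (x : Space d) :
    ‖mollify n g x‖ ≤ mollify n (fun y => ‖g y‖) x := by
  simp only [mollify, convolution_def]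
  refine (norm_integral_le_integral_norm _).trans (le_of_eq ?_)
  congr 1
  ext y
  simp [norm_smul, abs_of_nonneg ((shrinkingBump n).nonneg_normed y)]

theorem integral_mollify [CompleteSpace F] {g : Space d → F} (hg : Integrable g volume) (n : ℕ) :
    ∫ x, mollify n g x = ∫ x, g x := by
  unfold mollify
  rw [integral_convolution _ ((shrinkingBump n).integrable_normed) hg,
    (shrinkingBump n).integral_normed]
  simp

/-- The difference is dominated by `mollify n |g| + |g|`, which converges almost everywhere and
whose integral is independent of `n`, as the mollifier has mass one. -/
theorem tendsto_lintegral_mollify_sub [CompleteSpace F] {g : Space d → F} (hg : Integrable g volume) :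
    Tendsto (fun n => ∫⁻ x, ‖mollify n g x - g x‖ₑ) atTop (𝓝 0) := by
  have hgl := hg.locallyIntegrable
  have hgn := hg.norm.locallyIntegrable
  have hnn : ∀ n x, 0 ≤ mollify n (fun y => ‖g y‖) x := fun n x =>
    (norm_nonneg (mollify n g x)).trans (norm_mollify_le n x)
  have hmi : ∀ n, Integrable (mollify n fun y => ‖g y‖) volume := fun n =>
    Integrable.integrable_convolution _ ((shrinkingBump n).integrable_normed) hg.norm
  refine tendsto_lintegral_zero_of_le_of_tendsto
    (G := fun n x => ENNReal.ofReal (mollify n (fun y => ‖g y‖) x) + ‖g x‖ₑ)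
    (G' := fun x => ‖g x‖ₑ + ‖g x‖ₑ) ?_ ?_ ?_ ?_ ?_ ?_ ?_
  · intro n
    exact ((contDiff_mollify hgl n).continuous.aestronglyMeasurable.sub
      hg.aestronglyMeasurable).enorm
  · intro n
    exact ((contDiff_mollify hgn n).continuous.measurable.ennreal_ofReal.aemeasurable).add
      hg.aestronglyMeasurable.enorm
  · intro n x
    refine (enorm_sub_le).trans (add_le_add ?_ le_rfl)
    rw [← ofReal_norm]
    exact ENNReal.ofReal_le_ofReal (norm_mollify_le n x)
  · filter_upwards [ae_tendsto_mollify hgl] with x hx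
    have := (hx.sub_const (g x)).enorm
    simpa using this
  · filter_upwards [ae_tendsto_mollify hgn] with x hx
    have := (ENNReal.tendsto_ofReal hx).add_const ‖g x‖ₑ
    rwa [ofReal_norm] at this
  · intro n
    rw [lintegral_add_right' _ hg.aestronglyMeasurable.enorm,
      lintegral_add_right' _ hg.aestronglyMeasurable.enorm]
    congr 1
    rw [← ofReal_integral_eq_lintegral_ofReal (hmi n) (Eventually.of_forall (hnn n)),
      integral_mollify hg.norm, ofReal_integral_norm_eq_lintegral_enorm hg]
  · rw [lintegral_add_right' _ hg.aestronglyMeasurable.enorm]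
    exact ENNReal.add_ne_top.2 ⟨hg.2.ne, hg.2.ne⟩

end

/-- `g` is the derivative of `f` in direction `e` in the sense of distributions. -/
structure HasWeakDeriv {d : ℕ} (f g : Space d → ℂ) (e : Space d) : Prop where
  locallyIntegrable : LocallyIntegrable f volume
  locallyIntegrable_deriv : LocallyIntegrable g volume
  integral_eq : ∀ ψ : 𝓓((⊤ : Opens (Space d)), ℂ),
    ∫ x, f x * fderiv ℝ ψ x e = - ∫ x, g x * ψ x

/-- The derivative falls on the mollifier, and `y ↦ ρ (x - y)` is an admissible test function. The
sign from reflecting the argument cancels the one in the weak formulation. -/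
theorem HasWeakDeriv.fderiv_mollify {d : ℕ} {f g : Space d → ℂ} {e : Space d}
    (h : HasWeakDeriv f g e) (n : ℕ) (x : Space d) :
    fderiv ℝ (mollify n f) x e = mollify n g x := by
  set ρ := (shrinkingBump (E := Space d) n).normed volume with hρ
  have hcs : HasCompactSupport ρ := (shrinkingBump n).hasCompactSupport_normed
  have hcd : ContDiff ℝ ∞ ρ := (shrinkingBump n).contDiff_normed
  have hd := hcs.hasFDerivAt_convolution_left (ContinuousLinearMap.lsmul ℝ ℝ)
    (hcd.of_le (by exact_mod_cast le_top)) h.locallyIntegrable x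
  have hex : ConvolutionExistsAt (fderiv ℝ ρ) f x
      ((ContinuousLinearMap.lsmul ℝ ℝ).precompL (Space d)) volume :=
    (hcs.fderiv ℝ).convolutionExists_left _ (hcd.continuous_fderiv (by simp)) h.locallyIntegrable x
  have h1 : fderiv ℝ (mollify n f) x e = ∫ t, fderiv ℝ ρ t e • f (x - t) := by
    unfold mollify
    rw [hd.fderiv, convolution_def, ContinuousLinearMap.integral_apply hex]
    rfl
  let ψ : 𝓓((⊤ : Opens (Space d)), ℂ) :=
    { toFun := fun y => (ρ (x - y) : ℂ)
      contDiff' := Complex.ofRealCLM.contDiff.comp (hcd.comp (contDiff_const.sub contDiff_id))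
      hasCompactSupport' := by
        have : HasCompactSupport fun y => ρ (x - y) :=
          hcs.comp_homeomorph (Homeomorph.subLeft x)
        exact this.comp_left (g := fun r : ℝ => (r : ℂ)) (by simp)
      tsupport_subset' := fun _ _ => trivial }
  have hψ : ∀ y, fderiv ℝ ψ y e = - ((fderiv ℝ ρ (x - y) e : ℝ) : ℂ) := by
    intro y
    have h2 : HasFDerivAt ρ (fderiv ℝ ρ (x - y)) (x - y) :=
      (hcd.differentiable (by simp)).differentiableAt.hasFDerivAt
    have h3 := Complex.ofRealCLM.hasFDerivAt.comp y
      (h2.comp y ((hasFDerivAt_const x y).sub (hasFDerivAt_id y)))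
    have h4 : HasFDerivAt (ψ : Space d → ℂ) _ y := h3
    rw [h4.fderiv]
    simp
  have key := h.integral_eq ψ
  rw [h1, ← integral_sub_left_eq_self _ volume x]
  have h5 : ∫ t, fderiv ℝ ρ (x - t) e • f (x - (x - t)) = - ∫ y, f y * fderiv ℝ ψ y e := by
    rw [← integral_neg]
    congr 1
    ext t
    rw [hψ]
    simp [mul_comm]
  rw [h5, key, neg_neg]
  unfold mollify
  rw [convolution_def, ← integral_sub_left_eq_self _ volume x]
  congr 1
  ext t
  simp [ψ, hρ, mul_comm]

end KatoVanishing

/-! ### The chain rule for weak derivatives -/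

namespace KatoVanishing
open scoped Convolution ContDiff

/-- All the bumps live in the unit ball. This locality reduces `L¹` convergence on a compact set to
the integrable case, by truncating outside a ball larger by one. -/
theorem mollify_eq_of_eqOn {d : ℕ} {F : Type*} [NormedAddCommGroup F] [NormedSpace ℝ F]
    {g g' : Space d → F} (n : ℕ) (x : Space d) (h : ∀ y, dist y x ≤ 1 → g y = g' y) :
    mollify n g x = mollify n g' x := by
  simp only [mollify, convolution_def]
  congr 1
  ext t
  by_cases ht : t ∈ Function.support ((shrinkingBump (E := Space d) n).normed volume)
  · rw [ContDiffBump.support_normed_eq, Metric.mem_ball, dist_zero_right] at ht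
    have h1 : (shrinkingBump (E := Space d) n).rOut ≤ 1 := by
      simp only [shrinkingBump]
      rw [div_le_one (by positivity)]
      linarith [(n.cast_nonneg : (0 : ℝ) ≤ n)]
    rw [h (x - t)]
    rw [dist_eq_norm]
    simpa using ht.le.trans h1
  · rw [Function.notMem_support] at ht
    simp [ht]

theorem tendsto_setLIntegral_mollify_sub {d : ℕ} {F : Type*} [NormedAddCommGroup F]
    [NormedSpace ℝ F] [CompleteSpace F]
    {g : Space d → F} (hg : LocallyIntegrable g volume) {K : Set (Space d)} (hK : IsCompact K) :
    Tendsto (fun n => ∫⁻ x in K, ‖mollify n g x - g x‖ₑ) atTop (𝓝 0) := by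
  obtain ⟨R, hR⟩ := hK.isBounded.subset_closedBall (0 : Space d)
  set B := Metric.closedBall (0 : Space d) (R + 1) with hB
  have hi : Integrable (B.indicator g) volume :=
    (hg.integrableOn_isCompact (isCompact_closedBall _ _)).integrable_indicator
      Metric.isClosed_closedBall.measurableSet
  refine tendsto_of_tendsto_of_tendsto_of_le_of_le tendsto_const_nhds
    (tendsto_lintegral_mollify_sub hi) (fun _ => zero_le) fun n => ?_
  refine le_trans (le_of_eq ?_) (setLIntegral_le_lintegral K _)
  refine setLIntegral_congr_fun hK.measurableSet fun x hx => ?_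
  have hxR : ‖x‖ ≤ R := by simpa using hR hx
  have h1 : ∀ y, dist y x ≤ 1 → g y = B.indicator g y := by
    intro y hy
    rw [Set.indicator_of_mem]
    rw [hB, Metric.mem_closedBall, dist_zero_right]
    rw [dist_eq_norm] at hy
    calc ‖y‖ = ‖x + (y - x)‖ := by congr 1; abel
      _ ≤ ‖x‖ + ‖y - x‖ := norm_add_le _ _
      _ ≤ R + 1 := by linarith
  rw [mollify_eq_of_eqOn n x h1, h1 x (by simp)]

/-- The identity is classical for the mollified functions. Bounds on `β` and its derivative allow
passage to the limit although `g` is only locally integrable. -/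
theorem HasWeakDeriv.integral_comp_mul_fderiv {d : ℕ} {f g : Space d → ℂ} {e : Space d}
    (h : HasWeakDeriv f g e) {β : ℂ → ℝ} {M : ℝ} (hβ : ContDiff ℝ 1 β) (hβM : ∀ z, |β z| ≤ M)
    (hβ' : ∀ z, ‖fderiv ℝ β z‖ ≤ M) {η : Space d → ℝ} (hη : ContDiff ℝ 1 η)
    (hηc : HasCompactSupport η) :
    ∫ x, β (f x) * fderiv ℝ η x e = - ∫ x, fderiv ℝ β (f x) (g x) * η x := by
  have hM : 0 ≤ M := (abs_nonneg _).trans (hβM 0)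
  have hβd : Continuous (fderiv ℝ β) := hβ.continuous_fderiv one_ne_zero
  have hfm := h.locallyIntegrable.aestronglyMeasurable
  have hgm := h.locallyIntegrable_deriv.aestronglyMeasurable
  have hf1 : ∀ n, ContDiff ℝ 1 (mollify n f) := fun n =>
    (contDiff_mollify h.locallyIntegrable n).of_le (by exact_mod_cast le_top)
  have hgc : ∀ n, Continuous (mollify n g) := fun n =>
    (contDiff_mollify h.locallyIntegrable_deriv n).continuous
  have hηd : Continuous fun x => fderiv ℝ η x e :=
    (hη.continuous_fderiv one_ne_zero).clm_apply continuous_const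
  have hηdc : HasCompactSupport fun x => fderiv ℝ η x e := by
    have := hηc.fderiv ℝ
    exact this.comp_left (g := fun L : Space d →L[ℝ] ℝ => L e) (by simp)
  have hac : ∀ n, Continuous fun x => fderiv ℝ β (mollify n f x) (mollify n g x) := fun n =>
    (hβd.comp (hf1 n).continuous).clm_apply (hgc n)
  have hderiv : ∀ n x, fderiv ℝ (fun x => β (mollify n f x)) x e
      = fderiv ℝ β (mollify n f x) (mollify n g x) := by
    intro n x
    have h1 : HasFDerivAt β (fderiv ℝ β (mollify n f x)) (mollify n f x) :=
      (hβ.differentiable one_ne_zero).differentiableAt.hasFDerivAt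
    have h2 : HasFDerivAt (mollify n f) (fderiv ℝ (mollify n f) x) x :=
      ((hf1 n).differentiable one_ne_zero).differentiableAt.hasFDerivAt
    have h3 : HasFDerivAt (fun x => β (mollify n f x)) _ x := h1.comp x h2
    rw [h3.fderiv, ContinuousLinearMap.comp_apply, h.fderiv_mollify]
  have hparts : ∀ n, ∫ x, β (mollify n f x) * fderiv ℝ η x e
      = - ∫ x, fderiv ℝ β (mollify n f x) (mollify n g x) * η x := by
    intro n
    have hβf : Continuous fun x => β (mollify n f x) := hβ.continuous.comp (hf1 n).continuous
    have := integral_mul_fderiv_eq_neg_fderiv_mul_of_integrable (𝕜 := ℝ)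
      (f := fun x => β (mollify n f x)) (g := η) (v := e) (μ := volume) ?_ ?_ ?_
      (fun x _ => ((hβ.comp (hf1 n)).differentiable one_ne_zero).differentiableAt)
      (fun x _ => (hη.differentiable one_ne_zero).differentiableAt)
    · rw [this]
      simp_rw [hderiv]
    · simp_rw [hderiv]
      exact ((hac n).mul hη.continuous).integrable_of_hasCompactSupport hηc.mul_left
    · exact (hβf.mul hηd).integrable_of_hasCompactSupport hηdc.mul_left
    · exact (hβf.mul hη.continuous).integrable_of_hasCompactSupport hηc.mul_left
  have hae := ae_tendsto_mollify h.locallyIntegrable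
  have hleft : Tendsto (fun n => ∫ x, β (mollify n f x) * fderiv ℝ η x e) atTop
      (𝓝 (∫ x, β (f x) * fderiv ℝ η x e)) := by
    refine tendsto_integral_of_dominated_convergence (fun x => M * |fderiv ℝ η x e|) ?_ ?_ ?_ ?_
    · exact fun n => ((hβ.continuous.comp (hf1 n).continuous).mul hηd).aestronglyMeasurable
    · exact ((hηd.integrable_of_hasCompactSupport hηdc).norm).const_mul M
    · intro n
      refine Eventually.of_forall fun x => ?_
      rw [Real.norm_eq_abs, abs_mul]
      exact mul_le_mul_of_nonneg_right (hβM _) (abs_nonneg _)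
    · filter_upwards [hae] with x hx
      exact ((hβ.continuous.tendsto _).comp hx).mul_const _
  have hgη : Integrable (fun x => ‖η x • g x‖) volume :=
    (h.locallyIntegrable_deriv.integrable_smul_left_of_hasCompactSupport hη.continuous hηc).norm
  have hbm : ∀ n, AEStronglyMeasurable
      (fun x => fderiv ℝ β (mollify n f x) (g x) * η x) volume := fun n =>
    ((ContinuousLinearMap.id ℝ (ℂ →L[ℝ] ℝ)).aestronglyMeasurable_comp₂
      (hβd.comp (hf1 n).continuous).aestronglyMeasurable hgm).mul
      hη.continuous.aestronglyMeasurable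
  have hbb : ∀ n x, ‖fderiv ℝ β (mollify n f x) (g x) * η x‖ ≤ M * ‖η x • g x‖ := by
    intro n x
    rw [norm_mul, norm_smul]
    calc ‖fderiv ℝ β (mollify n f x) (g x)‖ * ‖η x‖ ≤ (M * ‖g x‖) * ‖η x‖ := by
          gcongr
          exact ((fderiv ℝ β _).le_opNorm _).trans (by gcongr; exact hβ' _)
      _ = _ := by ring
  -- The limit on the right is split in two: here only the coefficient `β'(f_n)` moves, and
  -- dominated convergence applies with `g` fixed.
  have hb : Tendsto (fun n => ∫ x, fderiv ℝ β (mollify n f x) (g x) * η x) atTop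
      (𝓝 (∫ x, fderiv ℝ β (f x) (g x) * η x)) := by
    refine tendsto_integral_of_dominated_convergence (fun x => M * ‖η x • g x‖) hbm
      (hgη.const_mul M) (fun n => Eventually.of_forall (hbb n)) ?_
    filter_upwards [hae] with x hx
    have h1 : Tendsto (fun n => fderiv ℝ β (mollify n f x)) atTop (𝓝 (fderiv ℝ β (f x))) :=
      (hβd.tendsto _).comp hx
    exact (((ContinuousLinearMap.apply ℝ ℝ (g x)).continuous.tendsto _).comp h1).mul_const _
  obtain ⟨C, hC⟩ := hη.continuous.bounded_above_of_compact_support hηc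
  have hC0 : 0 ≤ C := (norm_nonneg _).trans (hC 0)
  have hai : ∀ n, Integrable (fun x => fderiv ℝ β (mollify n f x) (mollify n g x) * η x) volume :=
    fun n => ((hac n).mul hη.continuous).integrable_of_hasCompactSupport hηc.mul_left
  have hbi : ∀ n, Integrable (fun x => fderiv ℝ β (mollify n f x) (g x) * η x) volume :=
    fun n => (hgη.const_mul M).mono' (hbm n) (Eventually.of_forall (hbb n))
  -- Replacing the mollified `g` by `g` costs at most `M * C` times their `L¹` distance on the
  -- support of `η`.
  have hdiff : Tendsto (fun n => ∫ x, (fderiv ℝ β (mollify n f x) (mollify n g x) * η x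
      - fderiv ℝ β (mollify n f x) (g x) * η x)) atTop (𝓝 0) := by
    have hz := tendsto_integral_of_L1 (μ := volume) (fun _ : Space d => (0 : ℝ))
      aestronglyMeasurable_const (F := fun n x => fderiv ℝ β (mollify n f x) (mollify n g x) * η x
      - fderiv ℝ β (mollify n f x) (g x) * η x) (l := atTop)
      (Eventually.of_forall fun n => (hai n).sub (hbi n)) ?_
    · simpa using hz
    have hlim := ENNReal.Tendsto.const_mul
      (tendsto_setLIntegral_mollify_sub h.locallyIntegrable_deriv hηc.isCompact)
      (a := ENNReal.ofReal (M * C)) (Or.inr ENNReal.ofReal_ne_top)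
    rw [mul_zero] at hlim
    refine tendsto_of_tendsto_of_tendsto_of_le_of_le tendsto_const_nhds hlim
      (fun _ => zero_le) fun n => ?_
    simp only
    rw [← lintegral_const_mul' _ _ ENNReal.ofReal_ne_top,
      ← lintegral_indicator (isClosed_tsupport η).measurableSet]
    refine lintegral_mono fun x => ?_
    by_cases hx : x ∈ tsupport η
    · rw [Set.indicator_of_mem hx, ← ofReal_norm, ← ofReal_norm,
        ← ENNReal.ofReal_mul (by positivity)]
      refine ENNReal.ofReal_le_ofReal ?_
      rw [sub_zero, ← sub_mul, ← map_sub, norm_mul]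
      calc ‖fderiv ℝ β (mollify n f x) (mollify n g x - g x)‖ * ‖η x‖
          ≤ (M * ‖mollify n g x - g x‖) * C := by
            gcongr
            · exact ((fderiv ℝ β _).le_opNorm _).trans (by gcongr; exact hβ' _)
            · exact hC x
        _ = _ := by ring
    · rw [image_eq_zero_of_notMem_tsupport hx]
      simp
  have hright : Tendsto (fun n => ∫ x, fderiv ℝ β (mollify n f x) (mollify n g x) * η x) atTop
      (𝓝 (∫ x, fderiv ℝ β (f x) (g x) * η x)) := by
    have := hdiff.add hb
    rw [zero_add] at this
    refine this.congr fun n => ?_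
    rw [integral_sub (hai n) (hbi n)]
    ring
  refine tendsto_nhds_unique hleft ?_
  simp_rw [hparts]
  exact hright.neg

/-- A bounded regularization of the square modulus. -/
noncomputable def boundedSq (ε : ℝ) (z : ℂ) : ℝ := ‖z‖ ^ 2 / (1 + ε * ‖z‖ ^ 2)

theorem hasFDerivAt_boundedSq {ε : ℝ} (hε : 0 < ε) (z : ℂ) :
    HasFDerivAt (boundedSq ε)
      ((2 / (1 + ε * ‖z‖ ^ 2) ^ 2) • (innerSL ℝ z)) z := by
  have h1 : HasFDerivAt (fun z : ℂ => ‖z‖ ^ 2) (2 • (innerSL ℝ z)) z :=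
    (hasStrictFDerivAt_norm_sq z).hasFDerivAt
  have hpos : 0 < 1 + ε * ‖z‖ ^ 2 := by positivity
  have h2 : HasDerivAt (fun s : ℝ => s / (1 + ε * s)) (1 / (1 + ε * ‖z‖ ^ 2) ^ 2) (‖z‖ ^ 2) := by
    have := (hasDerivAt_id (‖z‖ ^ 2)).div
      ((hasDerivAt_const (‖z‖ ^ 2) (1 : ℝ)).add ((hasDerivAt_id (‖z‖ ^ 2)).const_mul ε)) hpos.ne'
    exact this.congr_deriv (by simp; ring)
  have h3 := h2.comp_hasFDerivAt z h1
  refine h3.congr_fderiv ?_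
  ext w
  simp
  ring

theorem contDiff_boundedSq {ε : ℝ} (hε : 0 < ε) : ContDiff ℝ 1 (boundedSq ε) := by
  unfold boundedSq
  refine (contDiff_norm_sq ℝ).div (contDiff_const.add (contDiff_const.mul (contDiff_norm_sq ℝ)))
    fun z => ?_
  positivity

theorem abs_boundedSq_le {ε : ℝ} (hε : 0 < ε) (z : ℂ) : |boundedSq ε z| ≤ ‖z‖ ^ 2 := by
  unfold boundedSq
  rw [abs_of_nonneg (by positivity)]
  exact div_le_self (by positivity) (by nlinarith [mul_nonneg hε.le (sq_nonneg ‖z‖)])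

theorem abs_boundedSq_le' {ε : ℝ} (hε : 0 < ε) (z : ℂ) : |boundedSq ε z| ≤ 1 / ε := by
  unfold boundedSq
  rw [abs_of_nonneg (by positivity), div_le_div_iff₀ (by positivity) hε]
  linarith

theorem norm_fderiv_boundedSq_le {ε : ℝ} (hε : 0 < ε) (z : ℂ) :
    ‖fderiv ℝ (boundedSq ε) z‖ ≤ 1 + 1 / ε := by
  rw [(hasFDerivAt_boundedSq hε z).fderiv, norm_smul, innerSL_apply_norm, Real.norm_eq_abs,
    abs_of_nonneg (by positivity), div_mul_eq_mul_div, div_le_iff₀ (by positivity)]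
  have h1 : 2 * ‖z‖ ≤ 1 + ‖z‖ ^ 2 := by nlinarith [sq_nonneg (‖z‖ - 1)]
  have h2 : 1 + ‖z‖ ^ 2 ≤ (1 + 1 / ε) * (1 + ε * ‖z‖ ^ 2) := by
    have : (1 + 1 / ε) * (1 + ε * ‖z‖ ^ 2) = 1 + ‖z‖ ^ 2 + (1 / ε + ε * ‖z‖ ^ 2) := by
      field_simp
      ring
    rw [this]
    have : 0 ≤ 1 / ε + ε * ‖z‖ ^ 2 := by positivity
    linarith
  refine h1.trans (h2.trans ?_)
  have h3 : 1 ≤ 1 + ε * ‖z‖ ^ 2 := by nlinarith [mul_nonneg hε.le (sq_nonneg ‖z‖)]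
  gcongr
  nlinarith

end KatoVanishing

/-! ### The weak gradient of the square modulus -/

namespace KatoVanishing
open scoped ContDiff

variable {d : ℕ}

theorem LocL2.memLp_apply {A : Space d → Space d} (hA : LocL2 A) (j : Fin d) {K : Set (Space d)}
    (hK : IsCompact K) : MemLp (fun x => A x j) 2 (volume.restrict K) :=
  (hA K hK).continuousLinearMap_comp (EuclideanSpace.proj j : Space d →L[ℝ] ℝ)

theorem LocL2.locallyIntegrable_apply {A : Space d → Space d} (hA : LocL2 A) (j : Fin d) :
    LocallyIntegrable (fun x => A x j) volume := by
  rw [locallyIntegrable_iff]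
  intro K hK
  have : IsFiniteMeasure (volume.restrict K) := ⟨by simpa using hK.measure_lt_top⟩
  exact (hA.memLp_apply j hK).integrable one_le_two

theorem LocL2.locallyIntegrable_mul {A : Space d → Space d} (hA : LocL2 A) (j : Fin d)
    {φ : Space d → ℂ} (hφ : MemLp φ 2 volume) :
    LocallyIntegrable (fun x => ((A x j : ℝ) : ℂ) * φ x) volume := by
  rw [locallyIntegrable_iff]
  intro K hK
  exact MemLp.integrable_mul (hA.memLp_apply j hK).ofReal (hφ.restrict K)

theorem TestFunction.integrable_mul {f : Space d → ℂ} (hf : LocallyIntegrable f volume)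
    {ψ : Space d → ℂ} (hψ : Continuous ψ) (hψc : HasCompactSupport ψ) :
    Integrable (fun x => f x * ψ x) volume := by
  have := hf.integrable_smul_left_of_hasCompactSupport hψ hψc
  simpa [mul_comm] using this

theorem continuous_fderiv_testFunction (ψ : 𝓓((⊤ : Opens (Space d)), ℂ)) (e : Space d) :
    Continuous fun x => fderiv ℝ ψ x e :=
  (ψ.contDiff.continuous_fderiv (by simp)).clm_apply continuous_const

theorem hasCompactSupport_fderiv_testFunction (ψ : 𝓓((⊤ : Opens (Space d)), ℂ)) (e : Space d) :
    HasCompactSupport fun x => fderiv ℝ ψ x e :=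
  (ψ.hasCompactSupport.fderiv ℝ).comp_left (g := fun L : Space d →L[ℝ] ℂ => L e) (by simp)

theorem memLp_euclidean_apply {v : Space d → EuclideanSpace ℂ (Fin d)} (hv : MemLp v 2 volume)
    (j : Fin d) : MemLp (fun x => v x j) 2 volume :=
  hv.continuousLinearMap_comp (EuclideanSpace.proj j : EuclideanSpace ℂ (Fin d) →L[ℂ] ℂ)

/-- Solving `-i∂_jφ - A_jφ = v_j` for `∂_jφ`. The product `A_jφ` of an `L²_loc` and an `L²` function
is only locally integrable. -/
theorem HasMagneticMomentum.hasWeakDeriv {A : Space d → Space d} (hA : LocL2 A)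
    {φ : Space d → ℂ} {v : Space d → EuclideanSpace ℂ (Fin d)} (h : HasMagneticMomentum A φ v)
    (j : Fin d) :
    HasWeakDeriv φ (fun x => Complex.I * (v x j + ((A x j : ℝ) : ℂ) * φ x)) (basisVec j) := by
  have hφl := h.memLp_fun.locallyIntegrable one_le_two
  have hvl := (memLp_euclidean_apply h.memLp_momentum j).locallyIntegrable one_le_two
  have hAφ := hA.locallyIntegrable_mul j h.memLp_fun
  have hsum : LocallyIntegrable
      (fun x => Complex.I * (v x j + ((A x j : ℝ) : ℂ) * φ x)) volume :=
    (hvl.add hAφ).smul Complex.I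
  refine ⟨hφl, hsum, fun ψ => ?_⟩
  have i1 := TestFunction.integrable_mul hφl (continuous_fderiv_testFunction ψ (basisVec j))
    (hasCompactSupport_fderiv_testFunction ψ (basisVec j))
  have i2 := TestFunction.integrable_mul hAφ ψ.continuous ψ.hasCompactSupport
  have i3 := TestFunction.integrable_mul hvl ψ.continuous ψ.hasCompactSupport
  have key := h.weak_eq ψ j
  have e1 : ∫ x, φ x * (Complex.I * fderiv ℝ ψ x (basisVec j) - ((A x j : ℝ) : ℂ) * ψ x)
      = Complex.I * (∫ x, φ x * fderiv ℝ ψ x (basisVec j))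
        - ∫ x, ((A x j : ℝ) : ℂ) * φ x * ψ x := by
    rw [← integral_const_mul, ← integral_sub (i1.const_mul _) i2]
    congr 1
    ext x
    ring
  have e2 : ∫ x, Complex.I * (v x j + ((A x j : ℝ) : ℂ) * φ x) * ψ x
      = Complex.I * ((∫ x, v x j * ψ x) + ∫ x, ((A x j : ℝ) : ℂ) * φ x * ψ x) := by
    rw [← integral_add i3 i2, ← integral_const_mul]
    congr 1
    ext x
    ring
  rw [e2, ← key, e1]
  linear_combination (∫ x, φ x * fderiv ℝ ψ x (basisVec j)) * Complex.I_mul_I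

theorem integrable_normSq_mul {φ : Space d → ℂ} (hφ : MemLp φ 2 volume) {f : Space d → ℝ}
    (hf : Continuous f) {C : ℝ} (hC : ∀ x, |f x| ≤ C) :
    Integrable (fun x => ‖φ x‖ ^ 2 * f x) volume :=
  (hφ.integrable_norm_pow two_ne_zero).mul_bdd (c := C) hf.aestronglyMeasurable
    (Eventually.of_forall hC)

theorem integrable_im_mul {φ u : Space d → ℂ} (hφ : MemLp φ 2 volume) (hu : MemLp u 2 volume) :
    Integrable (fun x => 2 * (starRingEnd ℂ (φ x) * u x).im) volume :=
  ((hφ.star.integrable_mul hu).im).const_mul 2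

/-- The distributional derivative of `|φ|²` is `-2 Im (conj φ ((P - A) φ)_j)`. -/
theorem HasMagneticMomentum.integral_normSq_mul_fderiv {A : Space d → Space d} (hA : LocL2 A)
    {φ : Space d → ℂ} {v : Space d → EuclideanSpace ℂ (Fin d)} (h : HasMagneticMomentum A φ v)
    (j : Fin d) {η : Space d → ℝ} (hη : ContDiff ℝ 1 η) (hηc : HasCompactSupport η) :
    ∫ x, ‖φ x‖ ^ 2 * fderiv ℝ η x (basisVec j)
      = ∫ x, 2 * (starRingEnd ℂ (φ x) * v x j).im * η x := by
  set g : Space d → ℂ := fun x => Complex.I * (v x j + ((A x j : ℝ) : ℂ) * φ x) with hg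
  have hw := h.hasWeakDeriv hA j
  have hvj := memLp_euclidean_apply h.memLp_momentum j
  have hηd : Continuous fun x => fderiv ℝ η x (basisVec j) :=
    (hη.continuous_fderiv one_ne_zero).clm_apply continuous_const
  have hηdc : HasCompactSupport fun x => fderiv ℝ η x (basisVec j) :=
    (hηc.fderiv ℝ).comp_left (g := fun L : Space d →L[ℝ] ℝ => L (basisVec j)) (by simp)
  obtain ⟨C, hC⟩ := hη.continuous.bounded_above_of_compact_support hηc
  obtain ⟨C', hC'⟩ := hηd.bounded_above_of_compact_support hηdc
  set ε : ℕ → ℝ := fun n => 1 / ((n : ℝ) + 1) with hε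
  have hε0 : ∀ n, 0 < ε n := fun n => by positivity
  have hεl : Tendsto ε atTop (𝓝 0) := tendsto_one_div_add_atTop_nhds_zero_nat
  -- The magnetic term contributes the real part of `i A_j |φ|²`, which is zero. What is left is
  -- integrable uniformly in `n`.
  have hpt : ∀ n x, fderiv ℝ (boundedSq (ε n)) (φ x) (g x)
      = - (2 * (starRingEnd ℂ (φ x) * v x j).im) * (1 / (1 + ε n * ‖φ x‖ ^ 2) ^ 2) := by
    intro n x
    rw [(hasFDerivAt_boundedSq (hε0 n) (φ x)).fderiv]
    simp only [_root_.smul_apply, innerSL_apply_apply, Complex.inner, hg, smul_eq_mul]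
    have : (Complex.I * (v x j + ((A x j : ℝ) : ℂ) * φ x) * starRingEnd ℂ (φ x)).re
        = - (starRingEnd ℂ (φ x) * v x j).im := by
      simp [Complex.mul_re, Complex.mul_im]
      ring
    rw [this]
    ring
  have hn : ∀ n, ∫ x, boundedSq (ε n) (φ x) * fderiv ℝ η x (basisVec j)
      = ∫ x, 2 * (starRingEnd ℂ (φ x) * v x j).im * (1 / (1 + ε n * ‖φ x‖ ^ 2) ^ 2) * η x := by
    intro n
    rw [hw.integral_comp_mul_fderiv (M := 1 + 1 / ε n) (contDiff_boundedSq (hε0 n))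
      (fun z => (abs_boundedSq_le' (hε0 n) z).trans (by linarith))
      (norm_fderiv_boundedSq_le (hε0 n)) hη hηc, ← integral_neg]
    congr 1
    ext x
    rw [hpt]
    ring
  have hφm := h.memLp_fun.aestronglyMeasurable
  have him := integrable_im_mul h.memLp_fun hvj
  have hε1 : ∀ x, Tendsto (fun n => 1 + ε n * ‖φ x‖ ^ 2) atTop (𝓝 1) := by
    intro x
    have := (hεl.mul_const (‖φ x‖ ^ 2)).const_add 1
    simpa using this
  have hL : Tendsto (fun n => ∫ x, boundedSq (ε n) (φ x) * fderiv ℝ η x (basisVec j)) atTop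
      (𝓝 (∫ x, ‖φ x‖ ^ 2 * fderiv ℝ η x (basisVec j))) := by
    refine tendsto_integral_of_dominated_convergence
      (fun x => ‖‖φ x‖ ^ 2 * fderiv ℝ η x (basisVec j)‖) ?_
      (integrable_normSq_mul h.memLp_fun hηd hC').norm ?_ ?_
    · intro n
      exact ((contDiff_boundedSq (hε0 n)).continuous.comp_aestronglyMeasurable hφm).mul
        hηd.aestronglyMeasurable
    · intro n
      refine Eventually.of_forall fun x => ?_
      rw [norm_mul, norm_mul]
      gcongr
      rw [Real.norm_eq_abs]
      exact (abs_boundedSq_le (hε0 n) _).trans (le_abs_self _)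
    · refine Eventually.of_forall fun x => ?_
      refine Tendsto.mul_const _ ?_
      have := (tendsto_const_nhds (x := ‖φ x‖ ^ 2)).div (hε1 x) one_ne_zero
      rw [div_one] at this
      exact this
  have hR : Tendsto (fun n => ∫ x, 2 * (starRingEnd ℂ (φ x) * v x j).im *
      (1 / (1 + ε n * ‖φ x‖ ^ 2) ^ 2) * η x) atTop
      (𝓝 (∫ x, 2 * (starRingEnd ℂ (φ x) * v x j).im * η x)) := by
    refine tendsto_integral_of_dominated_convergence
      (fun x => ‖2 * (starRingEnd ℂ (φ x) * v x j).im‖ * C) ?_ (him.norm.mul_const C) ?_ ?_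
    · intro n
      refine (him.aestronglyMeasurable.mul ?_).mul hη.continuous.aestronglyMeasurable
      have hc : Continuous fun s : ℂ => 1 / (1 + ε n * ‖s‖ ^ 2) ^ 2 := by
        refine continuous_const.div (by fun_prop) fun s => ?_
        have := hε0 n
        positivity
      exact hc.comp_aestronglyMeasurable hφm
    · intro n
      refine Eventually.of_forall fun x => ?_
      rw [norm_mul, norm_mul]
      have h1 : ‖1 / (1 + ε n * ‖φ x‖ ^ 2) ^ 2‖ ≤ 1 := by
        have h2 : 0 ≤ ε n * ‖φ x‖ ^ 2 := by have := hε0 n; positivity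
        rw [Real.norm_eq_abs, abs_of_nonneg (by positivity), div_le_one (by positivity)]
        nlinarith
      calc _ ≤ ‖2 * (starRingEnd ℂ (φ x) * v x j).im‖ * 1 * C := by
            gcongr
            exact hC x
        _ = _ := by ring
    · refine Eventually.of_forall fun x => ?_
      refine Tendsto.mul_const _ ?_
      have := ((tendsto_const_nhds (x := (1 : ℝ))).div ((hε1 x).pow 2) (by norm_num)).const_mul
        (2 * (starRingEnd ℂ (φ x) * v x j).im)
      simpa using this
  refine tendsto_nhds_unique hL ?_
  simp_rw [hn]
  exact hR

end KatoVanishing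

/-! ### A lower bound for the magnetic kinetic energy -/

namespace KatoVanishing
open scoped ContDiff

variable {d : ℕ}

/-- A version of `HasMagneticMomentum.integral_normSq_mul_fderiv` without compact support. -/
theorem HasMagneticMomentum.integral_normSq_mul_fderiv_of_bounded {A : Space d → Space d}
    (hA : LocL2 A) {φ : Space d → ℂ} {v : Space d → EuclideanSpace ℂ (Fin d)}
    (h : HasMagneticMomentum A φ v) (j : Fin d) {η : Space d → ℝ} (hη : ContDiff ℝ 1 η) {C : ℝ}
    (hC : ∀ x, |η x| ≤ C) (hC' : ∀ x, |fderiv ℝ η x (basisVec j)| ≤ C) :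
    ∫ x, ‖φ x‖ ^ 2 * fderiv ℝ η x (basisVec j)
      = ∫ x, 2 * (starRingEnd ℂ (φ x) * v x j).im * η x := by
  have hC0 : 0 ≤ C := (abs_nonneg _).trans (hC 0)
  -- The dilated cutoffs `χ(ε x)` have gradient of size `ε`, so the term in which the derivative
  -- hits the cutoff disappears in the limit.
  let χ : ContDiffBump (0 : Space d) := ⟨1, 2, one_pos, one_lt_two⟩
  have hχd : ContDiff ℝ 1 χ := χ.contDiff
  have hχc : HasCompactSupport χ := χ.hasCompactSupport
  obtain ⟨D, hD⟩ := (hχd.continuous_fderiv one_ne_zero).bounded_above_of_compact_support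
    (hχc.fderiv ℝ)
  have hD0 : 0 ≤ D := (norm_nonneg _).trans (hD 0)
  set ε : ℕ → ℝ := fun n => 1 / ((n : ℝ) + 1) with hε
  have hε0 : ∀ n, 0 < ε n := fun n => by positivity
  have hε1 : ∀ n, ε n ≤ 1 := fun n => by
    rw [hε]
    simp only
    rw [div_le_one (by positivity)]
    linarith [(n.cast_nonneg : (0 : ℝ) ≤ n)]
  have hεl : Tendsto ε atTop (𝓝 0) := tendsto_one_div_add_atTop_nhds_zero_nat
  set χs : ℕ → Space d → ℝ := fun n x => χ (ε n • x) with hχs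
  have hχs1 : ∀ n, ContDiff ℝ 1 (χs n) := fun n => hχd.comp (contDiff_const_smul _)
  have hχsc : ∀ n, HasCompactSupport (χs n) := fun n =>
    hχc.comp_smul (hε0 n).ne'
  have hχs_le : ∀ n x, |χs n x| ≤ 1 := fun n x => by
    rw [abs_of_nonneg χ.nonneg]
    exact χ.le_one
  have hχfd : ∀ n x, HasFDerivAt (χs n) (ε n • fderiv ℝ χ (ε n • x)) x := by
    intro n x
    have h1 : HasFDerivAt χ (fderiv ℝ χ (ε n • x)) (ε n • x) :=
      (hχd.differentiable one_ne_zero).differentiableAt.hasFDerivAt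
    have h2 : HasFDerivAt (fun x : Space d => ε n • x) (ε n • ContinuousLinearMap.id ℝ (Space d)) x :=
      (hasFDerivAt_id x).const_smul (ε n)
    have h3 : HasFDerivAt (χs n) _ x := h1.comp x h2
    refine h3.congr_fderiv ?_
    ext w
    simp
  have hbasis : ‖(basisVec j : Space d)‖ = 1 := by simp [basisVec]
  have hχfd_le : ∀ n x, |fderiv ℝ (χs n) x (basisVec j)| ≤ ε n * D := by
    intro n x
    rw [(hχfd n x).fderiv, _root_.smul_apply, smul_eq_mul, abs_mul, abs_of_pos (hε0 n)]
    gcongr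
    have := (fderiv ℝ χ (ε n • x)).le_opNorm (basisVec j)
    rw [hbasis, mul_one] at this
    exact this.trans (hD _)
  have hχ_lim : ∀ x, Tendsto (fun n => χs n x) atTop (𝓝 1) := by
    intro x
    have h1 : Tendsto (fun n => ε n • x) atTop (𝓝 (0 : Space d)) := by
      simpa using hεl.smul_const x
    have h2 : Tendsto (fun n => χ (ε n • x)) atTop (𝓝 (χ 0)) :=
      (hχd.continuous.tendsto _).comp h1
    rwa [χ.one_of_mem_closedBall (Metric.mem_closedBall_self χ.rIn_pos.le)] at h2
  have hprod : ∀ n x, fderiv ℝ (fun x => χs n x * η x) x (basisVec j)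
      = χs n x * fderiv ℝ η x (basisVec j) + η x * fderiv ℝ (χs n) x (basisVec j) := by
    intro n x
    have h1 := ((hχs1 n).differentiable one_ne_zero).differentiableAt (x := x)
    have h2 := (hη.differentiable one_ne_zero).differentiableAt (x := x)
    rw [fderiv_fun_mul h1 h2]
    simp
  have hn : ∀ n, ∫ x, ‖φ x‖ ^ 2 *
      (χs n x * fderiv ℝ η x (basisVec j) + η x * fderiv ℝ (χs n) x (basisVec j))
      = ∫ x, 2 * (starRingEnd ℂ (φ x) * v x j).im * (χs n x * η x) := by
    intro n
    have := h.integral_normSq_mul_fderiv hA j ((hχs1 n).mul hη) ((hχsc n).mul_right (f' := η))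
    rw [← this]
    congr 1
    ext x
    rw [← hprod]
  have hηd : Continuous fun x => fderiv ℝ η x (basisVec j) :=
    (hη.continuous_fderiv one_ne_zero).clm_apply continuous_const
  have hχsd : ∀ n, Continuous fun x => fderiv ℝ (χs n) x (basisVec j) := fun n =>
    ((hχs1 n).continuous_fderiv one_ne_zero).clm_apply continuous_const
  have hφ2 : Integrable (fun x => ‖φ x‖ ^ 2) volume := h.memLp_fun.integrable_norm_pow two_ne_zero
  have him := integrable_im_mul h.memLp_fun (memLp_euclidean_apply h.memLp_momentum j)
  have hL : Tendsto (fun n => ∫ x, ‖φ x‖ ^ 2 *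
      (χs n x * fderiv ℝ η x (basisVec j) + η x * fderiv ℝ (χs n) x (basisVec j))) atTop
      (𝓝 (∫ x, ‖φ x‖ ^ 2 * fderiv ℝ η x (basisVec j))) := by
    refine tendsto_integral_of_dominated_convergence (fun x => ‖φ x‖ ^ 2 * (C + C * D)) ?_
      (hφ2.mul_const _) ?_ ?_
    · intro n
      exact hφ2.aestronglyMeasurable.mul ((((hχs1 n).continuous.mul hηd).add
        (hη.continuous.mul (hχsd n))).aestronglyMeasurable)
    · intro n
      refine Eventually.of_forall fun x => ?_
      rw [norm_mul, norm_pow, norm_norm, Real.norm_eq_abs]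
      gcongr
      refine (abs_add_le _ _).trans ?_
      rw [abs_mul, abs_mul]
      have h1 : |χs n x| * |fderiv ℝ η x (basisVec j)| ≤ 1 * C :=
        mul_le_mul (hχs_le n x) (hC' x) (abs_nonneg _) zero_le_one
      have h2 : |η x| * |fderiv ℝ (χs n) x (basisVec j)| ≤ C * D := by
        refine mul_le_mul (hC x) ((hχfd_le n x).trans ?_) (abs_nonneg _) hC0
        exact mul_le_of_le_one_left hD0 (hε1 n)
      linarith
    · refine Eventually.of_forall fun x => ?_
      have h1 : Tendsto (fun n => fderiv ℝ (χs n) x (basisVec j)) atTop (𝓝 0) := by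
        refine squeeze_zero_norm (fun n => hχfd_le n x) ?_
        simpa using hεl.mul_const D
      have := (((hχ_lim x).mul_const (fderiv ℝ η x (basisVec j))).add
        (h1.const_mul (η x))).const_mul (‖φ x‖ ^ 2)
      simpa using this
  have hR : Tendsto (fun n => ∫ x, 2 * (starRingEnd ℂ (φ x) * v x j).im * (χs n x * η x)) atTop
      (𝓝 (∫ x, 2 * (starRingEnd ℂ (φ x) * v x j).im * η x)) := by
    refine tendsto_integral_of_dominated_convergence
      (fun x => ‖2 * (starRingEnd ℂ (φ x) * v x j).im‖ * C) ?_ (him.norm.mul_const C) ?_ ?_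
    · intro n
      exact him.aestronglyMeasurable.mul
        (((hχs1 n).continuous.mul hη.continuous).aestronglyMeasurable)
    · intro n
      refine Eventually.of_forall fun x => ?_
      rw [norm_mul]
      gcongr
      rw [Real.norm_eq_abs, abs_mul]
      calc |χs n x| * |η x| ≤ 1 * C := mul_le_mul (hχs_le n x) (hC x) (abs_nonneg _) zero_le_one
        _ = C := one_mul C
    · refine Eventually.of_forall fun x => ?_
      have := ((hχ_lim x).mul_const (η x)).const_mul (2 * (starRingEnd ℂ (φ x) * v x j).im)
      simpa using this
  refine tendsto_nhds_unique hL ?_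
  simp_rw [hn]
  exact hR

/-- This is `0 ≤ |w + i t z|²` expanded. -/
theorem neg_two_mul_im_mul_le (z w : ℂ) (t : ℝ) :
    -(2 * (starRingEnd ℂ z * w).im * t) ≤ ‖w‖ ^ 2 + t ^ 2 * ‖z‖ ^ 2 := by
  rw [← Complex.normSq_eq_norm_sq, ← Complex.normSq_eq_norm_sq, Complex.normSq_apply,
    Complex.normSq_apply]
  simp only [Complex.mul_im, Complex.conj_re, Complex.conj_im]
  nlinarith [sq_nonneg (w.re - t * z.im), sq_nonneg (w.im + t * z.re)]

/-- A lower bound for the magnetic kinetic energy by the potential `-div F - |F|²`. -/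
theorem HasMagneticMomentum.integral_neg_div_sub_sq_le {A : Space d → Space d}
    (hA : LocL2 A) {φ : Space d → ℂ} {v : Space d → EuclideanSpace ℂ (Fin d)}
    (h : HasMagneticMomentum A φ v) {F : Fin d → Space d → ℝ} (hF : ∀ j, ContDiff ℝ 1 (F j))
    {C : ℝ} (hC : ∀ j x, |F j x| ≤ C) (hC' : ∀ j x, |fderiv ℝ (F j) x (basisVec j)| ≤ C) :
    ∫ x, (∑ j, (-fderiv ℝ (F j) x (basisVec j) - F j x ^ 2)) * ‖φ x‖ ^ 2 ≤ l2NormSq v := by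
  have hvj := fun j => memLp_euclidean_apply h.memLp_momentum j
  have hFd : ∀ j, Continuous fun x => fderiv ℝ (F j) x (basisVec j) := fun j =>
    ((hF j).continuous_fderiv one_ne_zero).clm_apply continuous_const
  have i1 : ∀ j, Integrable (fun x => ‖φ x‖ ^ 2 * fderiv ℝ (F j) x (basisVec j)) volume :=
    fun j => integrable_normSq_mul h.memLp_fun (hFd j) (hC' j)
  have i2 : ∀ j, Integrable (fun x => ‖φ x‖ ^ 2 * F j x ^ 2) volume := fun j =>
    integrable_normSq_mul (C := C ^ 2) h.memLp_fun ((hF j).continuous.pow 2) fun x => by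
      rw [abs_of_nonneg (sq_nonneg _), ← sq_abs]
      gcongr
      exact hC j x
  have i3 : ∀ j, Integrable (fun x => 2 * (starRingEnd ℂ (φ x) * v x j).im * F j x) volume :=
    fun j => (integrable_im_mul h.memLp_fun (hvj j)).mul_bdd (c := C)
      (hF j).continuous.aestronglyMeasurable (Eventually.of_forall (hC j))
  have i1n : ∀ j, Integrable (fun x => -(‖φ x‖ ^ 2 * fderiv ℝ (F j) x (basisVec j))) volume :=
    fun j => (i1 j).neg
  have i3n : ∀ j, Integrable (fun x => -(2 * (starRingEnd ℂ (φ x) * v x j).im * F j x)) volume :=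
    fun j => (i3 j).neg
  have i12 : ∀ j, Integrable (fun x => -(‖φ x‖ ^ 2 * fderiv ℝ (F j) x (basisVec j))
      - ‖φ x‖ ^ 2 * F j x ^ 2) volume := fun j => (i1n j).sub (i2 j)
  have i4 : ∀ j, Integrable (fun x => ‖v x j‖ ^ 2) volume := fun j =>
    (hvj j).integrable_norm_pow two_ne_zero
  have e1 : ∫ x, (∑ j, (-fderiv ℝ (F j) x (basisVec j) - F j x ^ 2)) * ‖φ x‖ ^ 2
      = ∑ j, ∫ x, (-(‖φ x‖ ^ 2 * fderiv ℝ (F j) x (basisVec j)) - ‖φ x‖ ^ 2 * F j x ^ 2) := by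
    rw [← integral_finsetSum _ fun j _ => i12 j]
    congr 1
    ext x
    rw [Finset.sum_mul]
    refine Finset.sum_congr rfl fun j _ => ?_
    ring
  have e2 : l2NormSq v = ∑ j, ∫ x, ‖v x j‖ ^ 2 := by
    unfold l2NormSq
    rw [← integral_finsetSum _ fun j _ => i4 j]
    congr 1
    ext x
    rw [EuclideanSpace.norm_sq_eq]
  rw [e1, e2]
  refine Finset.sum_le_sum fun j _ => ?_
  rw [integral_sub (i1n j) (i2 j), integral_neg,
    h.integral_normSq_mul_fderiv_of_bounded hA j (hF j) (hC j) (hC' j), ← integral_neg,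
    ← integral_sub (i3n j) (i2 j)]
  refine integral_mono ((i3n j).sub (i2 j)) (i4 j) fun x => ?_
  have := neg_two_mul_im_mul_le (φ x) (v x j) (F j x)
  simp only
  linarith

end KatoVanishing

/-! ### The truncated regularized Newtonian kernel -/

namespace KatoVanishing
open scoped ContDiff

variable {d : ℕ}

/-- A smooth cutoff, equal to `1` on `(-∞, 1/8]` and to `0` on `[1/4, ∞)`. -/
noncomputable def radialCutoff (s : ℝ) : ℝ := Real.smoothTransition (2 - 8 * s)

theorem radialCutoff_contDiff : ContDiff ℝ ∞ radialCutoff :=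
  Real.smoothTransition.contDiff.comp (contDiff_const.sub (contDiff_const.mul contDiff_id))

theorem radialCutoff_nonneg (s : ℝ) : 0 ≤ radialCutoff s := Real.smoothTransition.nonneg _

theorem radialCutoff_le_one (s : ℝ) : radialCutoff s ≤ 1 := Real.smoothTransition.le_one _

theorem radialCutoff_eq_zero {s : ℝ} (hs : 1 / 4 ≤ s) : radialCutoff s = 0 :=
  Real.smoothTransition.zero_of_nonpos (by linarith)

theorem radialCutoff_eq_one {s : ℝ} (hs : s ≤ 1 / 8) : radialCutoff s = 1 :=
  Real.smoothTransition.one_of_one_le (by linarith)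

theorem exists_abs_deriv_radialCutoff_le :
    ∃ M : ℝ, 0 ≤ M ∧ ∀ s ∈ Set.Icc (0 : ℝ) (1 / 4), |deriv radialCutoff s| ≤ M := by
  have hc : Continuous (deriv radialCutoff) :=
    radialCutoff_contDiff.continuous_deriv (by simp)
  obtain ⟨M, hM⟩ := isCompact_Icc.exists_bound_of_continuousOn hc.continuousOn
    (s := Set.Icc (0 : ℝ) (1 / 4))
  exact ⟨M, (norm_nonneg _).trans (hM 0 (by norm_num)), hM⟩

/-- The regularized, truncated profile `(s + δ²)^{-d/2}` as a function of `s = |x|²`. -/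
noncomputable def radialProfile (d : ℕ) (δ s : ℝ) : ℝ :=
  (s + δ ^ 2) ^ (-((d : ℝ) / 2)) * radialCutoff s

/-- The primitive of `radialProfile` vanishing for `s ≥ 1/4`. -/
noncomputable def radialPotential (d : ℕ) (δ s : ℝ) : ℝ :=
  (1 / 2) * ∫ σ in s..(1 / 4), radialProfile d δ σ

section
variable {δ : ℝ}

theorem contDiffAt_radialProfile (hδ : 0 < δ) {s : ℝ} (hs : 0 ≤ s) :
    ContDiffAt ℝ 1 (radialProfile d δ) s := by
  have h1 : s + δ ^ 2 ≠ 0 := by positivity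
  unfold radialProfile
  exact ((contDiffAt_id.add contDiffAt_const).rpow_const_of_ne h1).mul
    (radialCutoff_contDiff.contDiffAt.of_le (by exact_mod_cast le_top))

theorem hasDerivAt_radialProfile (hδ : 0 < δ) {s : ℝ} (hs : 0 ≤ s) :
    HasDerivAt (radialProfile d δ)
      (-((d : ℝ) / 2) * (s + δ ^ 2) ^ (-((d : ℝ) / 2) - 1) * radialCutoff s
        + (s + δ ^ 2) ^ (-((d : ℝ) / 2)) * deriv radialCutoff s) s := by
  have h1 : s + δ ^ 2 ≠ 0 := by positivity
  have h2 := ((hasDerivAt_id s).add_const (δ ^ 2)).rpow_const (p := -((d : ℝ) / 2)) (Or.inl h1)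
  have h3 : HasDerivAt radialCutoff (deriv radialCutoff s) s :=
    (radialCutoff_contDiff.differentiable (by simp)).differentiableAt.hasDerivAt
  have := h2.mul h3
  refine this.congr_deriv ?_
  simp

theorem radialProfile_nonneg {s : ℝ} (hs : 0 ≤ s) : 0 ≤ radialProfile d δ s :=
  mul_nonneg (Real.rpow_nonneg (by positivity) _) (radialCutoff_nonneg s)

theorem continuousOn_radialProfile (hδ : 0 < δ) :
    ContinuousOn (radialProfile d δ) (Set.Ici 0) := fun _ hs =>
  (contDiffAt_radialProfile hδ hs).continuousAt.continuousWithinAt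

theorem intervalIntegrable_radialProfile (hδ : 0 < δ) {a b : ℝ} (ha : 0 ≤ a) (hb : 0 ≤ b) :
    IntervalIntegrable (radialProfile d δ) volume a b :=
  ((continuousOn_radialProfile hδ).mono fun _ hx =>
    (le_min ha hb).trans hx.1).intervalIntegrable

theorem measurable_radialProfile : Measurable (radialProfile d δ) := by
  unfold radialProfile
  exact ((measurable_id.add_const _).pow_const _).mul radialCutoff_contDiff.continuous.measurable

/-- The factor `1/2` compensates the `2x` from differentiating `‖x‖²`, so that the gradient of
`newtonKernel` is exactly minus `newtonField`. -/
theorem hasDerivAt_radialPotential (hδ : 0 < δ) {s : ℝ} (hs : 0 ≤ s) :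
    HasDerivAt (radialPotential d δ) (-(1 / 2) * radialProfile d δ s) s := by
  have h := intervalIntegral.integral_hasDerivAt_left
    (intervalIntegrable_radialProfile (d := d) hδ hs (by norm_num : (0 : ℝ) ≤ 1 / 4))
    (measurable_radialProfile.stronglyMeasurable.stronglyMeasurableAtFilter)
    (contDiffAt_radialProfile hδ hs).continuousAt
  exact (h.const_mul (1 / 2)).congr_deriv (by ring)

theorem radialPotential_eq_zero {s : ℝ} (hs : 1 / 4 ≤ s) : radialPotential d δ s = 0 := by
  unfold radialPotential
  rw [intervalIntegral.integral_zero_ae, mul_zero]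
  refine Eventually.of_forall fun x hx => ?_
  rw [Set.uIoc_of_ge hs] at hx
  simp [radialProfile, radialCutoff_eq_zero hx.1.le]

theorem radialPotential_nonneg {s : ℝ} (hs : 0 ≤ s) : 0 ≤ radialPotential d δ s := by
  rcases le_total (1 / 4) s with h | h
  · rw [radialPotential_eq_zero h]
  · unfold radialPotential
    refine mul_nonneg (by norm_num) (intervalIntegral.integral_nonneg h fun u hu => ?_)
    exact radialProfile_nonneg (hs.trans hu.1)

theorem rpow_regularized_le {s : ℝ} (hs : 0 < s) :
    (s + δ ^ 2) ^ (-((d : ℝ) / 2)) ≤ s ^ (-((d : ℝ) / 2)) :=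
  Real.rpow_le_rpow_of_nonpos hs (by nlinarith [sq_nonneg δ]) (by simp; positivity)

theorem sq_rpow_neg_half {r : ℝ} (hr : 0 < r) (a : ℝ) : (r ^ 2) ^ (a / 2) = r ^ a := by
  rw [← Real.rpow_natCast_mul hr.le]
  congr 1
  push_cast
  ring

/-- Dropping the cutoff and the regularization leaves the primitive of `σ^{-d/2}`, which gives `-log
r - log 2` for `d = 2` and at most `r^{2-d}/(d-2)` for `d ≥ 3`. The bound does not depend on `δ`. -/
theorem radialPotential_le_katoKernel (hd : 2 ≤ d) (hδ : 0 < δ) {r : ℝ} (hr : 0 < r)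
    (hr2 : r ≤ 1 / 2) : radialPotential d δ (r ^ 2) ≤ katoKernel d r := by
  have hs : 0 < r ^ 2 := by positivity
  have hs4 : r ^ 2 ≤ 1 / 4 := by nlinarith
  have h0 : (0 : ℝ) ∉ Set.uIcc (r ^ 2) (1 / 4) := by
    rw [Set.uIcc_of_le hs4]
    exact fun h => absurd h.1 (not_le.2 hs)
  have hle : ∫ σ in (r ^ 2)..(1 / 4), radialProfile d δ σ
      ≤ ∫ σ in (r ^ 2)..(1 / 4), σ ^ (-((d : ℝ) / 2)) := by
    refine intervalIntegral.integral_mono_on hs4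
      (intervalIntegrable_radialProfile hδ hs.le (by norm_num))
      (intervalIntegral.intervalIntegrable_rpow (Or.inr h0)) fun x hx => ?_
    have hx0 : 0 < x := hs.trans_le hx.1
    calc radialProfile d δ x ≤ (x + δ ^ 2) ^ (-((d : ℝ) / 2)) * 1 :=
          mul_le_mul_of_nonneg_left (radialCutoff_le_one x) (Real.rpow_nonneg (by positivity) _)
      _ ≤ _ := by rw [mul_one]; exact rpow_regularized_le hx0
  refine (mul_le_mul_of_nonneg_left hle (by norm_num : (0 : ℝ) ≤ 1 / 2)).trans ?_
  rcases eq_or_lt_of_le hd with rfl | hd3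
  · have h1 : ∀ σ : ℝ, σ ^ (-(((2 : ℕ) : ℝ) / 2)) = σ⁻¹ := by
      intro σ
      rw [show -(((2 : ℕ) : ℝ) / 2) = -1 by norm_num, Real.rpow_neg_one]
    simp_rw [h1]
    rw [integral_inv h0, katoKernel, if_pos rfl, abs_of_nonpos (Real.log_nonpos hr.le (by linarith)),
      Real.log_div (by norm_num) hs.ne', Real.log_pow]
    have : Real.log (1 / 4) ≤ 0 := Real.log_nonpos (by norm_num) (by norm_num)
    push_cast
    linarith
  · have hd' : (3 : ℝ) ≤ d := by exact_mod_cast hd3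
    rw [integral_rpow (Or.inr ⟨by linarith, h0⟩), katoKernel, if_neg (by omega)]
    have h1 : (r ^ 2) ^ (-((d : ℝ) / 2) + 1) = r ^ (2 - (d : ℤ)) := by
      rw [show -((d : ℝ) / 2) + 1 = (2 - (d : ℝ)) / 2 by ring, sq_rpow_neg_half hr,
        ← Real.rpow_intCast]
      push_cast
      rfl
    rw [h1]
    have h2 : (0 : ℝ) ≤ (1 / 4) ^ (-((d : ℝ) / 2) + 1) := by positivity
    have h3 : (0 : ℝ) ≤ r ^ (2 - (d : ℤ)) := by positivity
    have h4 : (0 : ℝ) < (d : ℝ) / 2 - 1 := by linarith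
    rw [show -((d : ℝ) / 2) + 1 = -((d : ℝ) / 2 - 1) by ring] at *
    rw [div_neg, ← neg_div, neg_sub, ← mul_div_assoc, div_le_iff₀ h4]
    nlinarith

/-- The factor `2` is for `d = 2`, where the left side is `1` and `|log r| ≥ log 2 > 1/2`. This is
one reason for truncating at radius `1/2`: the logarithmic kernel vanishes at `1`. -/
theorem zpow_two_sub_le_katoKernel {r : ℝ} (hr : 0 < r) (hr2 : r ≤ 1 / 2) :
    r ^ (2 - (d : ℤ)) ≤ 2 * katoKernel d r := by
  unfold katoKernel
  split_ifs with h
  · subst h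
    have h1 : Real.log r ≤ Real.log (1 / 2) := Real.log_le_log hr hr2
    rw [one_div, Real.log_inv] at h1
    have h2 := Real.log_two_gt_d9
    rw [abs_of_nonpos (by linarith)]
    norm_num
    linarith
  · have : (0 : ℝ) ≤ r ^ (2 - (d : ℤ)) := by positivity
    linarith

theorem katoKernel_nonneg {r : ℝ} (hr : 0 ≤ r) : 0 ≤ katoKernel d r := by
  unfold katoKernel
  split_ifs
  · positivity
  · positivity

/-- A smooth compactly supported regularization of the Newtonian potential. -/
noncomputable def newtonKernel (d : ℕ) (δ : ℝ) (x : Space d) : ℝ := radialPotential d δ (‖x‖ ^ 2)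

/-- The components of minus the gradient of `newtonKernel`. -/
noncomputable def newtonField (d : ℕ) (δ : ℝ) (j : Fin d) (x : Space d) : ℝ :=
  radialProfile d δ (‖x‖ ^ 2) * x j

theorem hasFDerivAt_norm_sq' (x : Space d) :
    HasFDerivAt (fun x : Space d => ‖x‖ ^ 2) (2 • (innerSL ℝ x)) x :=
  (hasStrictFDerivAt_norm_sq x).hasFDerivAt

theorem hasFDerivAt_newtonKernel (hδ : 0 < δ) (x : Space d) :
    HasFDerivAt (newtonKernel d δ) ((-radialProfile d δ (‖x‖ ^ 2)) • innerSL ℝ x) x := by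
  have := (hasDerivAt_radialPotential (d := d) hδ (sq_nonneg ‖x‖)).comp_hasFDerivAt x
    (hasFDerivAt_norm_sq' x)
  refine this.congr_fderiv ?_
  ext w
  simp
  ring

theorem continuous_radialProfile_norm_sq (hδ : 0 < δ) :
    Continuous fun x : Space d => radialProfile d δ (‖x‖ ^ 2) := by
  rw [continuous_iff_continuousAt]
  intro x
  exact (contDiffAt_radialProfile hδ (sq_nonneg ‖x‖)).continuousAt.comp
    (f := fun x : Space d => ‖x‖ ^ 2) (by fun_prop)

theorem contDiff_newtonKernel (hδ : 0 < δ) : ContDiff ℝ 1 (newtonKernel d δ) := by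
  rw [contDiff_one_iff_fderiv]
  refine ⟨fun x => (hasFDerivAt_newtonKernel hδ x).differentiableAt, ?_⟩
  have : fderiv ℝ (newtonKernel d δ) =
      fun x => (-radialProfile d δ (‖x‖ ^ 2)) • innerSL ℝ x :=
    funext fun x => (hasFDerivAt_newtonKernel hδ x).fderiv
  rw [this]
  exact (continuous_radialProfile_norm_sq hδ).neg.smul (innerSL ℝ).continuous

theorem inner_basisVec (x : Space d) (j : Fin d) : inner ℝ x (basisVec j) = x j := by
  simp [basisVec, EuclideanSpace.inner_single_right]

theorem fderiv_newtonKernel (hδ : 0 < δ) (x : Space d) (j : Fin d) :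
    fderiv ℝ (newtonKernel d δ) x (basisVec j) = - newtonField d δ j x := by
  rw [(hasFDerivAt_newtonKernel hδ x).fderiv, _root_.smul_apply, innerSL_apply_apply,
    inner_basisVec, newtonField, smul_eq_mul, neg_mul]

theorem contDiff_newtonField (hδ : 0 < δ) (j : Fin d) : ContDiff ℝ 1 (newtonField d δ j) := by
  unfold newtonField
  refine ContDiff.mul ?_ (EuclideanSpace.proj j : Space d →L[ℝ] ℝ).contDiff
  rw [contDiff_iff_contDiffAt]
  intro x
  exact (contDiffAt_radialProfile hδ (sq_nonneg ‖x‖)).comp x (contDiff_norm_sq ℝ).contDiffAt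

theorem newtonKernel_eq_zero {x : Space d} (hx : 1 / 2 < ‖x‖) : newtonKernel d δ x = 0 :=
  radialPotential_eq_zero (by nlinarith)

theorem newtonField_eq_zero {x : Space d} (hx : 1 / 2 < ‖x‖) (j : Fin d) :
    newtonField d δ j x = 0 := by
  rw [newtonField, radialProfile, radialCutoff_eq_zero (by nlinarith)]
  simp

theorem newtonKernel_nonneg (x : Space d) : 0 ≤ newtonKernel d δ x :=
  radialPotential_nonneg (sq_nonneg _)

/-- Without regularization and cutoff the field is `x/|x|^d`, divergence free off the origin.
Writing `‖x‖² = (‖x‖² + δ²) - δ²` leaves a positive bump concentrated at scale `δ` and an error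
supported where the cutoff varies. -/
theorem sum_fderiv_newtonField (hδ : 0 < δ) (x : Space d) :
    ∑ j, fderiv ℝ (newtonField d δ j) x (basisVec j)
      = d * δ ^ 2 * (‖x‖ ^ 2 + δ ^ 2) ^ (-((d : ℝ) / 2) - 1) * radialCutoff (‖x‖ ^ 2)
        + 2 * ‖x‖ ^ 2 * (‖x‖ ^ 2 + δ ^ 2) ^ (-((d : ℝ) / 2)) * deriv radialCutoff (‖x‖ ^ 2) := by
  have hpos : 0 < ‖x‖ ^ 2 + δ ^ 2 := by positivity
  set m' : ℝ := (-((d : ℝ) / 2) * (‖x‖ ^ 2 + δ ^ 2) ^ (-((d : ℝ) / 2) - 1) * radialCutoff (‖x‖ ^ 2)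
        + (‖x‖ ^ 2 + δ ^ 2) ^ (-((d : ℝ) / 2)) * deriv radialCutoff (‖x‖ ^ 2)) with hm'
  have hj : ∀ j : Fin d, fderiv ℝ (newtonField d δ j) x (basisVec j)
      = radialProfile d δ (‖x‖ ^ 2) + 2 * m' * x j ^ 2 := by
    intro j
    have h1 := (hasDerivAt_radialProfile (d := d) hδ (sq_nonneg ‖x‖)).comp_hasFDerivAt x
      (hasFDerivAt_norm_sq' x)
    have h2 : HasFDerivAt (fun x : Space d => x j) (EuclideanSpace.proj j : Space d →L[ℝ] ℝ) x :=
      (EuclideanSpace.proj j : Space d →L[ℝ] ℝ).hasFDerivAt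
    have h3 : HasFDerivAt (newtonField d δ j) _ x := h1.mul h2
    rw [h3.fderiv]
    have h4 : (basisVec j : Space d) j = 1 := by simp [basisVec]
    simp only [Function.comp_apply, _root_.add_apply, _root_.smul_apply, innerSL_apply_apply,
      inner_basisVec, smul_eq_mul, nsmul_eq_mul, PiLp.proj_apply, h4]
    rw [← hm']
    push_cast
    ring
  simp_rw [hj]
  rw [Finset.sum_add_distrib, ← Finset.mul_sum, ← EuclideanSpace.real_norm_sq_eq]
  simp only [Finset.sum_const, Finset.card_univ, Fintype.card_fin, nsmul_eq_mul]
  have h5 : (‖x‖ ^ 2 + δ ^ 2) ^ (-((d : ℝ) / 2))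
      = (‖x‖ ^ 2 + δ ^ 2) ^ (-((d : ℝ) / 2) - 1) * (‖x‖ ^ 2 + δ ^ 2) := by
    rw [← Real.rpow_add_one hpos.ne', sub_add_cancel]
  rw [radialProfile, hm', h5]
  ring

end

end KatoVanishing

/-! ### Convolutions under a Kato bound -/

namespace KatoVanishing
open scoped ContDiff Convolution

variable {d : ℕ} {δ : ℝ}

/-- On the `δ`-ball `‖x‖² + δ² ≤ 2δ²`, which bounds the concentrating term below by a multiple of
`δ^{-d}`; elsewhere it is nonnegative. The cutoff error is at most `2M r^{2-d}`, hence controlled by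
`katoKernel`. -/
theorem le_sum_fderiv_newtonField (hδ : 0 < δ) (hδ4 : δ ≤ 1 / 4) {M : ℝ} (hM0 : 0 ≤ M)
    (hM : ∀ s ∈ Set.Icc (0 : ℝ) (1 / 4), |deriv radialCutoff s| ≤ M) {x : Space d} (hx : x ≠ 0)
    (hx2 : ‖x‖ ≤ 1 / 2) :
    (Metric.closedBall (0 : Space d) δ).indicator
        (fun _ => d * 2 ^ (-((d : ℝ) / 2) - 1) * (δ ^ d)⁻¹) x
      - 4 * M * katoKernel d ‖x‖ ≤ ∑ j, fderiv ℝ (newtonField d δ j) x (basisVec j) := by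
  have hr : 0 < ‖x‖ := norm_pos_iff.2 hx
  rw [sum_fderiv_newtonField hδ, sub_eq_add_neg]
  refine add_le_add ?_ ?_
  · have hnn : 0 ≤ d * δ ^ 2 * (‖x‖ ^ 2 + δ ^ 2) ^ (-((d : ℝ) / 2) - 1)
        * radialCutoff (‖x‖ ^ 2) :=
      mul_nonneg (by positivity) (radialCutoff_nonneg _)
    by_cases h : x ∈ Metric.closedBall (0 : Space d) δ
    · rw [Set.indicator_of_mem h]
      rw [Metric.mem_closedBall, dist_zero_right] at h
      have hsq : ‖x‖ ^ 2 ≤ δ ^ 2 := by gcongr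
      -- `δ ≤ 1/4` gives `‖x‖² ≤ 1/16 ≤ 1/8`, where the cutoff equals one.
      rw [radialCutoff_eq_one (by nlinarith), mul_one]
      have h1 : (2 * δ ^ 2) ^ (-((d : ℝ) / 2) - 1)
          ≤ (‖x‖ ^ 2 + δ ^ 2) ^ (-((d : ℝ) / 2) - 1) :=
        Real.rpow_le_rpow_of_nonpos (by positivity) (by linarith) (by
          have : (0 : ℝ) ≤ d := d.cast_nonneg
          linarith)
      have h2 : (2 * δ ^ 2) ^ (-((d : ℝ) / 2) - 1)
          = 2 ^ (-((d : ℝ) / 2) - 1) * (δ ^ (d + 2))⁻¹ := by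
        rw [Real.mul_rpow (by norm_num) (by positivity),
          show -((d : ℝ) / 2) - 1 = -((d + 2 : ℕ) : ℝ) / 2 by push_cast; ring,
          sq_rpow_neg_half hδ, Real.rpow_neg hδ.le, Real.rpow_natCast]
      calc d * 2 ^ (-((d : ℝ) / 2) - 1) * (δ ^ d)⁻¹
          = d * δ ^ 2 * (2 * δ ^ 2) ^ (-((d : ℝ) / 2) - 1) := by
            rw [h2, pow_add]
            field_simp
        _ ≤ _ := by gcongr
    · rw [Set.indicator_of_notMem h]
      exact hnn
  · have h1 : |2 * ‖x‖ ^ 2 * (‖x‖ ^ 2 + δ ^ 2) ^ (-((d : ℝ) / 2)) * deriv radialCutoff (‖x‖ ^ 2)|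
        ≤ 4 * M * katoKernel d ‖x‖ := by
      rw [abs_mul, abs_of_nonneg (by positivity : 0 ≤ 2 * ‖x‖ ^ 2 *
        (‖x‖ ^ 2 + δ ^ 2) ^ (-((d : ℝ) / 2)))]
      have h2 := hM (‖x‖ ^ 2) ⟨by positivity, by nlinarith⟩
      have h3 : (‖x‖ ^ 2 + δ ^ 2) ^ (-((d : ℝ) / 2)) ≤ (‖x‖ ^ 2) ^ (-((d : ℝ) / 2)) :=
        rpow_regularized_le (by positivity)
      have h4 : ‖x‖ ^ 2 * (‖x‖ ^ 2) ^ (-((d : ℝ) / 2)) = ‖x‖ ^ (2 - (d : ℤ)) := by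
        rw [← neg_div, sq_rpow_neg_half hr, ← Real.rpow_intCast, ← Real.rpow_natCast,
          ← Real.rpow_add hr]
        congr 1
        push_cast
        ring
      calc 2 * ‖x‖ ^ 2 * (‖x‖ ^ 2 + δ ^ 2) ^ (-((d : ℝ) / 2)) * |deriv radialCutoff (‖x‖ ^ 2)|
          ≤ 2 * ‖x‖ ^ 2 * (‖x‖ ^ 2) ^ (-((d : ℝ) / 2)) * M := by gcongr
        _ = 2 * M * (‖x‖ ^ 2 * (‖x‖ ^ 2) ^ (-((d : ℝ) / 2))) := by ring
        _ ≤ 2 * M * (2 * katoKernel d ‖x‖) := by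
            rw [h4]
            exact mul_le_mul_of_nonneg_left (zpow_two_sub_le_katoKernel hr hx2) (by positivity)
        _ = _ := by ring
    exact (abs_le.1 h1).1

/-! ### Convolution of `C¹` kernels with a potential -/

/-- The convolution of two real functions. -/
noncomputable def realConv (k W : Space d → ℝ) (x : Space d) : ℝ := ∫ t, k t * W (x - t)

theorem realConv_eq (k W : Space d → ℝ) :
    realConv k W = k ⋆[ContinuousLinearMap.lsmul ℝ ℝ, volume] W := rfl

section
variable {k W : Space d → ℝ}

theorem contDiff_realConv (hk : ContDiff ℝ 1 k) (hkc : HasCompactSupport k)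
    (hW : LocallyIntegrable W volume) : ContDiff ℝ 1 (realConv k W) := by
  rw [realConv_eq]
  exact hkc.contDiff_convolution_left _ (n := 1) hk hW

theorem integrable_realConv (hk : Continuous k) (hkc : HasCompactSupport k)
    (hW : LocallyIntegrable W volume) (x : Space d) :
    Integrable (fun t => k t * W (x - t)) volume :=
  hkc.convolutionExists_left (ContinuousLinearMap.lsmul ℝ ℝ) hk hW x

theorem fderiv_realConv (hk : ContDiff ℝ 1 k) (hkc : HasCompactSupport k)
    (hW : LocallyIntegrable W volume) (x e : Space d) :
    fderiv ℝ (realConv k W) x e = realConv (fun t => fderiv ℝ k t e) W x := by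
  have hd := hkc.hasFDerivAt_convolution_left (ContinuousLinearMap.lsmul ℝ ℝ) hk hW x
  have hex : ConvolutionExistsAt (fderiv ℝ k) W x
      ((ContinuousLinearMap.lsmul ℝ ℝ).precompL (Space d)) volume :=
    (hkc.fderiv ℝ).convolutionExists_left _ (hk.continuous_fderiv one_ne_zero) hW x
  rw [realConv_eq, hd.fderiv, convolution_def, ContinuousLinearMap.integral_apply hex]
  rfl

end

theorem hasCompactSupport_of_eq_zero {F : Type*} [Zero F] {k : Space d → F} {R : ℝ}
    (hk : ∀ x, R < ‖x‖ → k x = 0) : HasCompactSupport k :=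
  HasCompactSupport.intro (isCompact_closedBall (0 : Space d) R) fun x hx => hk x (by
    simpa using hx)

theorem fderiv_eq_zero_of_eq_zero {k : Space d → ℝ} {R : ℝ}
    (hk : ∀ x, R < ‖x‖ → k x = 0) {x : Space d} (hx : R < ‖x‖) : fderiv ℝ k x = 0 := by
  have : k =ᶠ[𝓝 x] fun _ => 0 := by
    filter_upwards [(isOpen_lt continuous_const continuous_norm).mem_nhds hx] with y hy
      using hk y hy
  rw [this.fderiv_eq]
  simp

theorem measurable_katoKernel : Measurable (katoKernel d) := by
  unfold katoKernel
  split_ifs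
  · exact Real.measurable_log.abs
  · exact measurable_id.pow_const _

theorem one_le_katoKernel (hd : 2 ≤ d) {r : ℝ} (hr : 0 < r) (hr2 : r ≤ 1 / 2) :
    1 ≤ 2 * katoKernel d r := by
  refine le_trans ?_ (zpow_two_sub_le_katoKernel hr hr2)
  exact one_le_zpow_of_nonpos₀ hr (by linarith) (by omega)

/-- At the origin `katoKernel` is the finite value assigned to `log 0` or `0^{2-d}`, or is otherwise
meaningless as a majorant. The kernel comparisons hold only away from this null point. -/
theorem ae_ne_zero (hd : 2 ≤ d) : ∀ᵐ x : Space d, x ≠ 0 := by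
  have : Nontrivial (Fin d) := Fin.nontrivial_iff_two_le.2 hd
  have : Nonempty (Fin d) := inferInstance
  have h : NullSingletonClass (volume : Measure (Space d)) := inferInstance
  exact (measure_eq_zero_iff_ae_notMem.1 (measure_singleton (0 : Space d)))

/-! ### Consequences of a Kato bound -/

/-- The Kato-type bound `∫_{|x-y| ≤ 1/2} g_d(x-y) |W(y)| dy ≤ κ` for all `x`. -/
def KatoBound (W : Space d → ℝ) (κ : ℝ≥0∞) : Prop :=
  ∀ x : Space d, ∫⁻ y in Metric.closedBall x (1 / 2),
    ENNReal.ofReal (katoKernel d ‖x - y‖) * ‖W y‖ₑ ≤ κ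

section
variable {W : Space d → ℝ} {κ : ℝ}

theorem KatoBound.lintegral_le (h : KatoBound W (ENNReal.ofReal κ)) (x : Space d) :
    ∫⁻ t in Metric.closedBall (0 : Space d) (1 / 2),
      ENNReal.ofReal (katoKernel d ‖t‖) * ‖W (x - t)‖ₑ ≤ ENNReal.ofReal κ := by
  refine le_trans (le_of_eq ?_) (h x)
  rw [← lintegral_indicator Metric.isClosed_closedBall.measurableSet,
    ← lintegral_indicator Metric.isClosed_closedBall.measurableSet,
    ← lintegral_sub_left_eq_self _ x]
  refine lintegral_congr fun t => ?_
  by_cases ht : t ∈ Metric.closedBall x (1 / 2)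
  · rw [Set.indicator_of_mem ht, Set.indicator_of_mem, sub_sub_cancel]
    rw [Metric.mem_closedBall, dist_comm, dist_eq_norm] at ht
    simpa using ht
  · rw [Set.indicator_of_notMem ht, Set.indicator_of_notMem]
    rw [Metric.mem_closedBall, dist_comm, dist_eq_norm] at ht
    simpa using ht

theorem aestronglyMeasurable_comp_sub_left (hW : AEStronglyMeasurable W volume) (x : Space d) :
    AEStronglyMeasurable (fun t => W (x - t)) volume :=
  hW.comp_measurePreserving (Measure.measurePreserving_sub_left volume x)

theorem KatoBound.integrableOn (h : KatoBound W (ENNReal.ofReal κ))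
    (hW : AEStronglyMeasurable W volume) (x : Space d) :
    IntegrableOn (fun t => katoKernel d ‖t‖ * W (x - t)) (Metric.closedBall 0 (1 / 2)) volume := by
  refine ⟨((measurable_katoKernel.comp measurable_norm).aestronglyMeasurable.mul
    (aestronglyMeasurable_comp_sub_left hW x)).restrict, ?_⟩
  refine lt_of_le_of_lt (le_of_eq ?_) ((h.lintegral_le x).trans_lt ENNReal.ofReal_lt_top)
  refine lintegral_congr fun t => ?_
  rw [enorm_mul, Real.enorm_of_nonneg (katoKernel_nonneg (norm_nonneg t))]

theorem KatoBound.integral_le (h : KatoBound W (ENNReal.ofReal κ)) (hκ : 0 ≤ κ)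
    (hW : AEStronglyMeasurable W volume) (hW0 : ∀ x, 0 ≤ W x) (x : Space d) :
    ∫ t in Metric.closedBall (0 : Space d) (1 / 2), katoKernel d ‖t‖ * W (x - t) ≤ κ := by
  have hnn : ∀ t, 0 ≤ katoKernel d ‖t‖ * W (x - t) := fun t =>
    mul_nonneg (katoKernel_nonneg (norm_nonneg t)) (hW0 _)
  rw [← ENNReal.ofReal_le_ofReal_iff hκ,
    ofReal_integral_eq_lintegral_ofReal (h.integrableOn hW x) (Eventually.of_forall hnn)]
  refine le_trans (le_of_eq ?_) (h.lintegral_le x)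
  refine lintegral_congr fun t => ?_
  rw [ENNReal.ofReal_mul (katoKernel_nonneg (norm_nonneg t)), Real.enorm_of_nonneg (hW0 _)]

theorem integrableOn_comp_sub_left (hW : LocallyIntegrable W volume) (x : Space d) (r : ℝ) :
    IntegrableOn (fun t => W (x - t)) (Metric.closedBall 0 r) volume := by
  have h := (hW.integrableOn_isCompact (isCompact_closedBall x r))
  have := (Measure.measurePreserving_sub_left volume x).integrableOn_comp_preimage
    (Homeomorph.subLeft x).measurableEmbedding (f := W) (s := Metric.closedBall x r)
  have h2 := this.2 h
  have e : Metric.closedBall (0 : Space d) r = (fun t => x - t) ⁻¹' Metric.closedBall x r := by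
    ext t
    simp [dist_eq_norm]
  rw [e]
  exact h2

theorem realConv_eq_setIntegral {k : Space d → ℝ} (hk : ∀ t, 1 / 2 < ‖t‖ → k t = 0)
    (x : Space d) : realConv k W x
      = ∫ t in Metric.closedBall (0 : Space d) (1 / 2), k t * W (x - t) := by
  rw [realConv, setIntegral_eq_integral_of_forall_compl_eq_zero]
  intro t ht
  rw [hk t (by simpa using ht), zero_mul]

theorem abs_realConv_le (hd : 2 ≤ d) (h : KatoBound W (ENNReal.ofReal κ)) (hκ : 0 ≤ κ)
    (hW : LocallyIntegrable W volume) (hW0 : ∀ x, 0 ≤ W x) {k : Space d → ℝ}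
    (hk : ∀ t, 1 / 2 < ‖t‖ → k t = 0) {C : ℝ} (hC0 : 0 ≤ C) (hC : ∀ t, t ≠ 0 → ‖t‖ ≤ 1 / 2 →
      |k t| ≤ C * katoKernel d ‖t‖) (x : Space d) :
    |realConv k W x| ≤ C * κ := by
  have hi := h.integrableOn hW.aestronglyMeasurable x
  rw [realConv_eq_setIntegral hk, ← Real.norm_eq_abs]
  refine (norm_integral_le_of_norm_le (hi.const_mul C) ?_).trans ?_
  · filter_upwards [ae_restrict_of_ae (ae_ne_zero hd),
      ae_restrict_mem Metric.isClosed_closedBall.measurableSet] with t ht0 ht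
    rw [norm_mul, Real.norm_eq_abs, Real.norm_of_nonneg (hW0 _), ← mul_assoc]
    exact mul_le_mul_of_nonneg_right (hC t ht0 (by simpa using ht)) (hW0 _)
  · rw [integral_const_mul]
    exact mul_le_mul_of_nonneg_left (h.integral_le hκ hW.aestronglyMeasurable hW0 x) hC0

/-- A bounded kernel is dominated by a multiple of `katoKernel`, which is at least `1/2` on the
ball. This yields the qualitative bounds needed to make `F = ∇w/w` admissible; they may blow up as
`δ → 0`. -/
theorem abs_realConv_le_of_bounded (hd : 2 ≤ d) (h : KatoBound W (ENNReal.ofReal κ)) (hκ : 0 ≤ κ)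
    (hW : LocallyIntegrable W volume) (hW0 : ∀ x, 0 ≤ W x) {k : Space d → ℝ}
    (hk : ∀ t, 1 / 2 < ‖t‖ → k t = 0) {C : ℝ} (hC : ∀ t, |k t| ≤ C) (x : Space d) :
    |realConv k W x| ≤ 2 * C * κ := by
  have hC0 : 0 ≤ C := (abs_nonneg _).trans (hC 0)
  refine abs_realConv_le hd h hκ hW hW0 hk (by positivity) (fun t ht0 ht => ?_) x
  refine (hC t).trans ?_
  have := one_le_katoKernel (d := d) hd (norm_pos_iff.2 ht0) ht
  nlinarith

/-- Applied to the divergence of `newtonField`: the indicator reproduces the integral of `W` over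
the `δ`-ball, and the kernel error costs at most `M * κ`. -/
theorem le_realConv (hd : 2 ≤ d) (h : KatoBound W (ENNReal.ofReal κ)) (hκ : 0 ≤ κ)
    (hW : LocallyIntegrable W volume) (hW0 : ∀ x, 0 ≤ W x) {k : Space d → ℝ}
    (hkc : Continuous k) (hk : ∀ t, 1 / 2 < ‖t‖ → k t = 0) {c M : ℝ} (hM : 0 ≤ M)
    (hδ : δ ≤ 1 / 2)
    (hle : ∀ t, t ≠ 0 → ‖t‖ ≤ 1 / 2 →
      (Metric.closedBall (0 : Space d) δ).indicator (fun _ => c) t - M * katoKernel d ‖t‖ ≤ k t)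
    (x : Space d) :
    c * (∫ y in Metric.closedBall x δ, W y) - M * κ ≤ realConv k W x := by
  have hi := h.integrableOn hW.aestronglyMeasurable x
  have hWi := integrableOn_comp_sub_left hW x (1 / 2)
  have hWd := integrableOn_comp_sub_left hW x δ
  have hki := (integrable_realConv hkc (hasCompactSupport_of_eq_zero hk) hW x).integrableOn
    (s := Metric.closedBall (0 : Space d) (1 / 2))
  have hmeas : MeasurableSet (Metric.closedBall (0 : Space d) δ) :=
    Metric.isClosed_closedBall.measurableSet
  have hind : IntegrableOn (fun t => (Metric.closedBall (0 : Space d) δ).indicator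
      (fun t => c * W (x - t)) t) (Metric.closedBall 0 (1 / 2)) volume :=
    (hWi.const_mul c).indicator hmeas
  have e1 : ∫ y in Metric.closedBall x δ, W y
      = ∫ t in Metric.closedBall (0 : Space d) δ, W (x - t) := by
    rw [← (Measure.measurePreserving_sub_left volume x).setIntegral_preimage_emb
      (Homeomorph.subLeft x).measurableEmbedding W (Metric.closedBall x δ)]
    congr 2
    ext t
    simp [dist_eq_norm]
  have e2 : c * (∫ y in Metric.closedBall x δ, W y)
      = ∫ t in Metric.closedBall (0 : Space d) (1 / 2),
        (Metric.closedBall (0 : Space d) δ).indicator (fun t => c * W (x - t)) t := by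
    rw [setIntegral_indicator hmeas,
      Set.inter_eq_self_of_subset_right (Metric.closedBall_subset_closedBall hδ),
      integral_const_mul, e1]
  have e3 : M * (∫ t in Metric.closedBall (0 : Space d) (1 / 2), katoKernel d ‖t‖ * W (x - t))
      ≤ M * κ :=
    mul_le_mul_of_nonneg_left (h.integral_le hκ hW.aestronglyMeasurable hW0 x) hM
  rw [realConv_eq_setIntegral hk]
  refine le_trans (sub_le_sub_left e3 _) ?_
  rw [e2, ← integral_const_mul, ← integral_sub hind (hi.const_mul M)]
  refine integral_mono_ae (hind.sub (hi.const_mul M)) hki ?_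
  filter_upwards [ae_restrict_of_ae (ae_ne_zero hd),
    ae_restrict_mem Metric.isClosed_closedBall.measurableSet] with t ht0 ht
  have h1 := mul_le_mul_of_nonneg_right (hle t ht0 (by simpa using ht)) (hW0 (x - t))
  refine le_trans (le_of_eq ?_) h1
  by_cases htd : t ∈ Metric.closedBall (0 : Space d) δ
  · simp only [Set.indicator_of_mem htd]
    ring
  · simp only [Set.indicator_of_notMem htd]
    ring

end

end KatoVanishing

/-! ### The form bound -/

namespace KatoVanishing
open scoped ContDiff

variable {d : ℕ} {δ κ : ℝ} {W : Space d → ℝ}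

theorem exists_uniform_bound {f : Fin d → Space d → ℝ} (h : ∀ j, ∃ C, ∀ x, |f j x| ≤ C) :
    ∃ C, ∀ j x, |f j x| ≤ C := by
  choose B hB using h
  have hB0 : ∀ j, 0 ≤ B j := fun j => (abs_nonneg _).trans (hB j 0)
  exact ⟨∑ j, B j, fun j x => (hB j x).trans
    (Finset.single_le_sum (f := B) (fun i _ => hB0 i) (Finset.mem_univ j))⟩

theorem realConv_newtonKernel_nonneg (hW0 : ∀ x, 0 ≤ W x) (x : Space d) :
    0 ≤ realConv (newtonKernel d δ) W x :=
  integral_nonneg fun t => mul_nonneg (newtonKernel_nonneg t) (hW0 _)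

theorem realConv_newtonKernel_le (hd : 2 ≤ d) (hδ : 0 < δ) (h : KatoBound W (ENNReal.ofReal κ))
    (hκ : 0 ≤ κ) (hW : LocallyIntegrable W volume) (hW0 : ∀ x, 0 ≤ W x) (x : Space d) :
    realConv (newtonKernel d δ) W x ≤ κ := by
  refine (le_abs_self _).trans ?_
  have := abs_realConv_le hd h hκ hW hW0 (k := newtonKernel d δ)
    (fun t ht => newtonKernel_eq_zero ht) zero_le_one (fun t ht0 ht => ?_) x
  · rwa [one_mul] at this
  · rw [abs_of_nonneg (newtonKernel_nonneg t), one_mul]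
    exact radialPotential_le_katoKernel hd hδ (norm_pos_iff.2 ht0) ht

/-- The ground state representation with the positive function `κ + newtonKernel ⋆ W`. -/
theorem HasMagneticMomentum.integral_div_newtonKernel_le (hd : 2 ≤ d) (hδ : 0 < δ)
    (h : KatoBound W (ENNReal.ofReal κ)) (hκ : 0 < κ) (hW : LocallyIntegrable W volume)
    (hW0 : ∀ x, 0 ≤ W x) {A : Space d → Space d} (hA : LocL2 A) {φ : Space d → ℂ}
    {v : Space d → EuclideanSpace ℂ (Fin d)} (hφ : HasMagneticMomentum A φ v) :
    (Continuous fun x => (realConv (fun t => ∑ j, fderiv ℝ (newtonField d δ j) t (basisVec j)) W x)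
      / (κ + realConv (newtonKernel d δ) W x)) ∧
    Integrable (fun x => (realConv (fun t => ∑ j, fderiv ℝ (newtonField d δ j) t (basisVec j)) W x)
      / (κ + realConv (newtonKernel d δ) W x) * ‖φ x‖ ^ 2) volume ∧
    ∫ x, (realConv (fun t => ∑ j, fderiv ℝ (newtonField d δ j) t (basisVec j)) W x)
      / (κ + realConv (newtonKernel d δ) W x) * ‖φ x‖ ^ 2 ≤ l2NormSq v := by
  set U := realConv (newtonKernel d δ) W with hU
  set G : Fin d → Space d → ℝ := fun j => realConv (newtonField d δ j) W with hG
  set E' : Fin d → Space d → ℝ := fun j t => fderiv ℝ (newtonField d δ j) t (basisVec j) with hE'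
  have hKc : HasCompactSupport (newtonKernel d δ) :=
    hasCompactSupport_of_eq_zero fun x hx => newtonKernel_eq_zero hx
  have hEc : ∀ j, HasCompactSupport (newtonField d δ j) := fun j =>
    hasCompactSupport_of_eq_zero fun x hx => newtonField_eq_zero hx j
  have hE0 : ∀ j t, 1 / 2 < ‖t‖ → E' j t = 0 := fun j t ht => by
    simp only [hE']
    rw [fderiv_eq_zero_of_eq_zero (fun x hx => newtonField_eq_zero hx j) ht]
    rfl
  have hE'c : ∀ j, Continuous (E' j) := fun j =>
    ((contDiff_newtonField hδ j).continuous_fderiv one_ne_zero).clm_apply continuous_const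
  have hU1 : ContDiff ℝ 1 U := contDiff_realConv (contDiff_newtonKernel hδ) hKc hW
  have hG1 : ∀ j, ContDiff ℝ 1 (G j) := fun j =>
    contDiff_realConv (contDiff_newtonField hδ j) (hEc j) hW
  have hUd : ∀ x j, fderiv ℝ U x (basisVec j) = - G j x := by
    intro x j
    rw [hU, fderiv_realConv (contDiff_newtonKernel hδ) hKc hW]
    simp only [fderiv_newtonKernel hδ, hG, realConv, neg_mul, integral_neg]
  have hGd : ∀ x j, fderiv ℝ (G j) x (basisVec j) = realConv (E' j) W x := fun x j =>
    fderiv_realConv (contDiff_newtonField hδ j) (hEc j) hW x _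
  have hU0 : ∀ x, 0 ≤ U x := realConv_newtonKernel_nonneg hW0
  have hw : ∀ x, κ ≤ κ + U x := fun x => by linarith [hU0 x]
  have hw0 : ∀ x, 0 < κ + U x := fun x => hκ.trans_le (hw x)
  have hsum : ∀ x, realConv (fun t => ∑ j, E' j t) W x
      = ∑ j, fderiv ℝ (G j) x (basisVec j) := by
    intro x
    simp_rw [hGd, realConv, Finset.sum_mul]
    exact integral_finsetSum _ fun j _ =>
      integrable_realConv (hE'c j) (hasCompactSupport_of_eq_zero (hE0 j)) hW x
  -- Since `∇U = -G`, this is `F = ∇w/w` for `w = κ + U`, and `-div F - |F|² = div G / w = -Δw/w`.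
  -- The constant `κ` keeps `w` away from zero.
  set F : Fin d → Space d → ℝ := fun j x => -(G j x) / (κ + U x) with hF
  have hF1 : ∀ j, ContDiff ℝ 1 (F j) := fun j =>
    (hG1 j).neg.div (contDiff_const.add hU1) fun x => (hw0 x).ne'
  have hFd : ∀ j x, -fderiv ℝ (F j) x (basisVec j) - F j x ^ 2
      = fderiv ℝ (G j) x (basisVec j) / (κ + U x) := by
    intro j x
    have h1 : HasFDerivAt (fun x => -(G j x)) (-fderiv ℝ (G j) x) x :=
      ((hG1 j).differentiable one_ne_zero).differentiableAt.hasFDerivAt.neg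
    have h2 : HasFDerivAt (fun x => κ + U x) (fderiv ℝ U x) x :=
      (hU1.differentiable one_ne_zero).differentiableAt.hasFDerivAt.const_add κ
    have h3 : HasFDerivAt (fun x => (κ + U x)⁻¹) _ x :=
      (hasDerivAt_inv (hw0 x).ne').comp_hasFDerivAt x h2
    have h4 : F j = fun x => -(G j x) * (κ + U x)⁻¹ := by
      ext x
      rw [← div_eq_mul_inv]
    rw [h4, (h1.fun_mul h3).fderiv]
    simp only [_root_.add_apply, _root_.smul_apply, _root_.neg_apply, smul_eq_mul, hUd]
    have := (hw0 x).ne'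
    field_simp
    ring
  obtain ⟨CG, hCG⟩ : ∃ C, ∀ j x, |G j x| ≤ C := exists_uniform_bound fun j => by
    obtain ⟨C, hC⟩ := (contDiff_newtonField hδ j).continuous.bounded_above_of_compact_support
      (hEc j)
    exact ⟨_, abs_realConv_le_of_bounded hd h hκ.le hW hW0
      (fun t ht => newtonField_eq_zero ht j) hC⟩
  obtain ⟨CD, hCD⟩ : ∃ C, ∀ j x, |realConv (E' j) W x| ≤ C := exists_uniform_bound fun j => by
    obtain ⟨C, hC⟩ := (hE'c j).bounded_above_of_compact_support
      (hasCompactSupport_of_eq_zero (hE0 j))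
    exact ⟨_, abs_realConv_le_of_bounded hd h hκ.le hW hW0 (hE0 j) hC⟩
  have hdivle : ∀ (y C : ℝ) x, |y| ≤ C → |y / (κ + U x)| ≤ C / κ := by
    intro y C x hy
    rw [abs_div, abs_of_pos (hw0 x)]
    exact div_le_div₀ ((abs_nonneg _).trans hy) hy hκ (hw x)
  have hFb : ∀ j x, |F j x| ≤ CG / κ := fun j x =>
    hdivle _ _ _ (by rw [abs_neg]; exact hCG j x)
  have hF'b : ∀ j x, |fderiv ℝ (F j) x (basisVec j)| ≤ CD / κ + (CG / κ) ^ 2 := by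
    intro j x
    have e : fderiv ℝ (F j) x (basisVec j)
        = -(realConv (E' j) W x / (κ + U x)) - F j x ^ 2 := by
      rw [← hGd, ← hFd j x]
      ring
    rw [e]
    refine (abs_sub _ _).trans (add_le_add ?_ ?_)
    · rw [abs_neg]
      exact hdivle _ _ _ (hCD j x)
    · rw [abs_of_nonneg (sq_nonneg _), ← sq_abs]
      gcongr
      exact hFb j x
  have key := hφ.integral_neg_div_sub_sq_le hA hF1
    (C := max (CG / κ) (CD / κ + (CG / κ) ^ 2)) (fun j x => (hFb j x).trans (le_max_left _ _))
    (fun j x => (hF'b j x).trans (le_max_right _ _))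
  have hpt : ∀ x, ∑ j, (-fderiv ℝ (F j) x (basisVec j) - F j x ^ 2)
      = realConv (fun t => ∑ j, E' j t) W x / (κ + U x) := by
    intro x
    rw [hsum, Finset.sum_div]
    exact Finset.sum_congr rfl fun j _ => hFd j x
  simp_rw [hpt] at key
  have hcont : Continuous fun x => realConv (fun t => ∑ j, E' j t) W x / (κ + U x) := by
    simp_rw [hsum]
    refine Continuous.div (continuous_finsetSum _ fun j _ => ?_)
      (continuous_const.add hU1.continuous) fun x => (hw0 x).ne'
    exact ((hG1 j).continuous_fderiv one_ne_zero).clm_apply continuous_const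
  refine ⟨hcont, ?_, key⟩
  have := integrable_normSq_mul hφ.memLp_fun hcont (C := ∑ _j : Fin d, CD / κ) fun x => ?_
  · simpa [mul_comm] using this
  · rw [hsum, Finset.sum_div]
    refine (Finset.abs_sum_le_sum_abs _ _).trans (Finset.sum_le_sum fun j _ => ?_)
    rw [hGd]
    exact hdivle _ _ _ (hCD j x)

/-- The ground state inequality bounds `∫ Q|φ|²` by the kinetic energy for every `δ`, and `Q + 4M`
dominates the average of `W` over `δ`-balls up to the factor `2κ`. The limit `δ → 0` turns averages
into `W`, with no boundedness assumption on `W`. -/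
theorem exists_lintegral_mul_normSq_le (hd : 2 ≤ d) :
    ∃ C : ℝ, 0 < C ∧ ∀ (W : Space d → ℝ) (κ : ℝ), 0 < κ → LocallyIntegrable W volume →
      (∀ x, 0 ≤ W x) → KatoBound W (ENNReal.ofReal κ) →
      ∀ A : Space d → Space d, LocL2 A → ∀ φ v, HasMagneticMomentum A φ v →
        ∫⁻ x, ENNReal.ofReal (W x * ‖φ x‖ ^ 2)
          ≤ ENNReal.ofReal (C * κ * (l2NormSq v + l2NormSq φ)) := by
  obtain ⟨M, hM0, hM⟩ := exists_abs_deriv_radialCutoff_le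
  set c₀ : ℝ := d * 2 ^ (-((d : ℝ) / 2) - 1) with hc₀
  set vB : ℝ := volume.real (Metric.ball (0 : Space d) 1) with hB
  have hd0 : (0 : ℝ) < d := by exact_mod_cast (by omega : 0 < d)
  have hc₀0 : 0 < c₀ := by positivity
  have hB0 : 0 < vB := ENNReal.toReal_pos (Metric.measure_ball_pos volume _ one_pos).ne'
    measure_ball_lt_top.ne
  refine ⟨2 * (1 + 4 * M) / (c₀ * vB), by positivity, ?_⟩
  intro W κ hκ hW hW0 h A hA φ v hφ
  set δ : ℕ → ℝ := fun n => (1 / 4) * (1 / ((n : ℝ) + 1)) with hδ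
  have hδ0 : ∀ n, 0 < δ n := fun n => by positivity
  have hδ4 : ∀ n, δ n ≤ 1 / 4 := fun n => by
    have : 1 / ((n : ℝ) + 1) ≤ 1 := by
      rw [div_le_one (by positivity)]
      linarith [(n.cast_nonneg : (0 : ℝ) ≤ n)]
    simp only [hδ]
    linarith
  have hδl : Tendsto δ atTop (𝓝[>] 0) := by
    refine tendsto_nhdsWithin_iff.2 ⟨?_, Eventually.of_forall hδ0⟩
    have := (tendsto_one_div_add_atTop_nhds_zero_nat (𝕜 := ℝ)).const_mul (1 / 4)
    rwa [mul_zero] at this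
  set Q : ℕ → Space d → ℝ := fun n x =>
    (realConv (fun t => ∑ j, fderiv ℝ (newtonField d (δ n) j) t (basisVec j)) W x)
      / (κ + realConv (newtonKernel d (δ n)) W x) with hQ
  have hmain := fun n => hφ.integral_div_newtonKernel_le hd (hδ0 n) h hκ hW hW0 hA
  have hQc : ∀ n, Continuous (Q n) := fun n => (hmain n).1
  have hQi : ∀ n, Integrable (fun x => Q n x * ‖φ x‖ ^ 2) volume := fun n => (hmain n).2.1
  have hQle : ∀ n, ∫ x, Q n x * ‖φ x‖ ^ 2 ≤ l2NormSq v := fun n => (hmain n).2.2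
  have hlow : ∀ n x, c₀ * vB * (⨍ y in Metric.closedBall x (δ n), W y) ≤ 2 * κ * (Q n x + 4 * M) := by
    intro n x
    have hvol : volume.real (Metric.closedBall x (δ n)) = δ n ^ d * vB := by
      rw [measureReal_def, Measure.addHaar_closedBall _ _ (hδ0 n).le, ENNReal.toReal_mul,
        ENNReal.toReal_ofReal (by have := hδ0 n; positivity), hB, measureReal_def]
      simp
    have h1 := le_realConv hd h hκ.le hW hW0
      (k := fun t => ∑ j, fderiv ℝ (newtonField d (δ n) j) t (basisVec j))
      (c := c₀ * (δ n ^ d)⁻¹) (M := 4 * M) (δ := δ n)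
      (continuous_finsetSum _ fun j _ =>
        ((contDiff_newtonField (hδ0 n) j).continuous_fderiv one_ne_zero).clm_apply continuous_const)
      (fun t ht => Finset.sum_eq_zero fun j _ => by
        rw [fderiv_eq_zero_of_eq_zero (fun x hx => newtonField_eq_zero hx j) ht]; rfl)
      (by positivity) (by linarith [hδ4 n])
      (fun t ht0 ht => le_sum_fderiv_newtonField (hδ0 n) (hδ4 n) hM0 hM ht0 ht) x
    have h2 : c₀ * vB * (⨍ y in Metric.closedBall x (δ n), W y)
        = c₀ * (δ n ^ d)⁻¹ * ∫ y in Metric.closedBall x (δ n), W y := by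
      rw [setAverage_eq, hvol, smul_eq_mul, mul_inv]
      field_simp
    rw [← h2] at h1
    have hU0 := realConv_newtonKernel_nonneg (δ := δ n) hW0 x
    have hU1 := realConv_newtonKernel_le hd (hδ0 n) h hκ.le hW hW0 x
    have h3 : Q n x * (κ + realConv (newtonKernel d (δ n)) W x)
        = realConv (fun t => ∑ j, fderiv ℝ (newtonField d (δ n) j) t (basisVec j)) W x := by
      simp only [hQ]
      exact div_mul_cancel₀ _ (by positivity)
    rw [← h3] at h1
    have h4 : 0 ≤ ⨍ y in Metric.closedBall x (δ n), W y := by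
      rw [setAverage_eq]
      exact smul_nonneg (by positivity) (integral_nonneg fun y => hW0 y)
    have h5 : 0 ≤ c₀ * vB * ⨍ y in Metric.closedBall x (δ n), W y := by positivity
    have h6 : c₀ * vB * (⨍ y in Metric.closedBall x (δ n), W y)
        ≤ (Q n x + 4 * M) * (κ + realConv (newtonKernel d (δ n)) W x) := by nlinarith
    -- The sign is needed to replace the denominator `κ + U` by its upper bound `2κ`. It holds
    -- because averages of `W` are nonnegative.
    have h7 : 0 ≤ Q n x + 4 * M := by
      have := h5.trans h6
      exact nonneg_of_mul_nonneg_left this (by positivity)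
    nlinarith
  have hae : ∀ᵐ x, Tendsto (fun n => ⨍ y in Metric.closedBall x (δ n), W y) atTop (𝓝 (W x)) := by
    filter_upwards [(Besicovitch.vitaliFamily (volume : Measure (Space d))).ae_tendsto_average hW]
      with x hx
    exact hx.comp ((Besicovitch.tendsto_filterAt volume x).comp hδl)
  have hφ2 : Integrable (fun x => ‖φ x‖ ^ 2) volume := hφ.memLp_fun.integrable_norm_pow two_ne_zero
  have hb : ∀ n, ∫⁻ x, ENNReal.ofReal (2 * κ * (Q n x + 4 * M) * ‖φ x‖ ^ 2)
      ≤ ENNReal.ofReal (2 * κ * (1 + 4 * M) * (l2NormSq v + l2NormSq φ)) := by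
    intro n
    have hi : Integrable (fun x => 2 * κ * (Q n x + 4 * M) * ‖φ x‖ ^ 2) volume := by
      have := ((hQi n).add (hφ2.const_mul (4 * M))).const_mul (2 * κ)
      refine this.congr (Eventually.of_forall fun x => ?_)
      simp only [Pi.add_apply]
      ring
    have hnn : ∀ x, 0 ≤ 2 * κ * (Q n x + 4 * M) * ‖φ x‖ ^ 2 := by
      intro x
      have h4 : 0 ≤ ⨍ y in Metric.closedBall x (δ n), W y := by
        rw [setAverage_eq]
        exact smul_nonneg (by positivity) (integral_nonneg fun y => hW0 y)
      have h5 : 0 ≤ c₀ * vB * ⨍ y in Metric.closedBall x (δ n), W y := by positivity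
      exact mul_nonneg (h5.trans (hlow n x)) (sq_nonneg _)
    rw [← ofReal_integral_eq_lintegral_ofReal hi (Eventually.of_forall hnn)]
    refine ENNReal.ofReal_le_ofReal ?_
    have e : ∫ x, 2 * κ * (Q n x + 4 * M) * ‖φ x‖ ^ 2
        = 2 * κ * ((∫ x, Q n x * ‖φ x‖ ^ 2) + 4 * M * l2NormSq φ) := by
      unfold l2NormSq
      rw [← integral_const_mul (4 * M), ← integral_add (hQi n) (hφ2.const_mul _),
        ← integral_const_mul]
      congr 1
      ext x
      ring
    rw [e]
    have hv0 : 0 ≤ l2NormSq v := integral_nonneg fun x => by positivity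
    have hφ0 : 0 ≤ l2NormSq φ := integral_nonneg fun x => by positivity
    have := hQle n
    rw [mul_assoc (2 * κ)]
    refine mul_le_mul_of_nonneg_left ?_ (by positivity)
    nlinarith
  -- Fatou suffices, as only an upper bound is wanted. It also proves that `W|φ|²` is integrable.
  have hfat : ∫⁻ x, ENNReal.ofReal (c₀ * vB * (W x * ‖φ x‖ ^ 2))
      ≤ ENNReal.ofReal (2 * κ * (1 + 4 * M) * (l2NormSq v + l2NormSq φ)) := by
    calc ∫⁻ x, ENNReal.ofReal (c₀ * vB * (W x * ‖φ x‖ ^ 2))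
        ≤ ∫⁻ x, liminf (fun n => ENNReal.ofReal (2 * κ * (Q n x + 4 * M) * ‖φ x‖ ^ 2)) atTop := by
          refine lintegral_mono_ae ?_
          filter_upwards [hae] with x hx
          have h1 : Tendsto (fun n => ENNReal.ofReal
              (c₀ * vB * (⨍ y in Metric.closedBall x (δ n), W y) * ‖φ x‖ ^ 2)) atTop
              (𝓝 (ENNReal.ofReal (c₀ * vB * W x * ‖φ x‖ ^ 2))) :=
            ENNReal.tendsto_ofReal ((hx.const_mul (c₀ * vB)).mul_const (‖φ x‖ ^ 2))
          rw [← mul_assoc, ← h1.liminf_eq]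
          refine liminf_le_liminf (Eventually.of_forall fun n => ENNReal.ofReal_le_ofReal ?_)
          exact mul_le_mul_of_nonneg_right (hlow n x) (sq_nonneg _)
      _ ≤ liminf (fun n => ∫⁻ x, ENNReal.ofReal (2 * κ * (Q n x + 4 * M) * ‖φ x‖ ^ 2)) atTop := by
          refine lintegral_liminf_le' fun n => AEMeasurable.ennreal_ofReal ?_
          exact ((((hQc n).add continuous_const).measurable.const_mul _).aemeasurable).mul
            hφ2.aestronglyMeasurable.aemeasurable
      _ ≤ _ := liminf_le_of_le (by isBoundedDefault) fun b hb' => by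
          obtain ⟨n, hn⟩ := hb'.exists
          exact hn.trans (hb n)
  have hcvB : 0 < c₀ * vB := by positivity
  have e1 : ∫⁻ x, ENNReal.ofReal (c₀ * vB * (W x * ‖φ x‖ ^ 2))
      = ENNReal.ofReal (c₀ * vB) * ∫⁻ x, ENNReal.ofReal (W x * ‖φ x‖ ^ 2) := by
    rw [← lintegral_const_mul' _ _ ENNReal.ofReal_ne_top]
    refine lintegral_congr fun x => ?_
    rw [ENNReal.ofReal_mul hcvB.le]
  have e2 : 2 * κ * (1 + 4 * M) * (l2NormSq v + l2NormSq φ)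
      = (c₀ * vB) * (2 * (1 + 4 * M) / (c₀ * vB) * κ * (l2NormSq v + l2NormSq φ)) := by
    field_simp
  rw [e1, e2, ENNReal.ofReal_mul hcvB.le] at hfat
  exact (ENNReal.mul_le_mul_iff_right (ENNReal.ofReal_pos.2 hcvB).ne' ENNReal.ofReal_ne_top).1 hfat

end KatoVanishing

/-! ### Potentials vanishing at infinity -/

namespace KatoVanishing

variable {d : ℕ} {W : Space d → ℝ}

theorem katoKernel_anti (hd : 2 ≤ d) {a r : ℝ} (ha : 0 < a) (har : a ≤ r) (hr : r ≤ 1) :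
    katoKernel d r ≤ katoKernel d a := by
  unfold katoKernel
  split_ifs
  · rw [abs_of_nonpos (Real.log_nonpos (by linarith) hr),
      abs_of_nonpos (Real.log_nonpos ha.le (har.trans hr))]
    exact neg_le_neg (Real.log_le_log ha har)
  · obtain ⟨n, rfl⟩ := Nat.exists_eq_add_of_le hd
    rw [show 2 - ((2 + n : ℕ) : ℤ) = -(n : ℤ) by push_cast; ring, zpow_neg, zpow_neg,
      zpow_natCast, zpow_natCast]
    exact inv_anti₀ (by positivity) (pow_le_pow_left₀ ha.le har n)

/-! ### Decay of the Kato bound at infinity -/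

theorem KatoBound.mono_fun {W' : Space d → ℝ} {κ : ℝ≥0∞} (h : KatoBound W κ)
    (hle : ∀ x, ‖W' x‖ₑ ≤ ‖W x‖ₑ) : KatoBound W' κ := fun x =>
  (lintegral_mono fun y => by gcongr; exact hle y).trans (h x)

/-- The ball of radius `1/2` is split at a small radius `a`. Inside, the Kato class gives `ε/2` once
`R` is so large that the exceptional compact set is excluded. Outside, the kernel is at most its
value at `a`, which is now fixed, so the uniform local `L¹` norm gives the other half as `R → ∞`. -/
theorem tendsto_katoBound (hd : 2 ≤ d) (hK : KatoClassOutsideCompact W)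
    (hV : VanishesLocUnifL1 W) {ε : ℝ≥0∞} (hε : 0 < ε) :
    ∀ᶠ R : ℝ in atTop, KatoBound ({x : Space d | R ≤ ‖x‖}.indicator W) ε := by
  obtain ⟨K, hKc, -, hKt⟩ := hK
  have hε2 : 0 < ε / 2 := ENNReal.half_pos hε.ne'
  have h1 := (ENNReal.tendsto_nhds_zero.1 hKt) (ε / 2) hε2
  have h2 : ∀ᶠ a : ℝ in 𝓝[>] 0, a < 1 / 2 :=
    (eventually_lt_nhds (by norm_num)).filter_mono nhdsWithin_le_nhds
  obtain ⟨a, ⟨ha1, ha2⟩, ha0⟩ := ((h1.and h2).and self_mem_nhdsWithin).exists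
  have ha0 : 0 < a := ha0
  obtain ⟨ρ, hρ⟩ := hKc.isBounded.subset_closedBall (0 : Space d)
  have h3 : Tendsto (fun R : ℝ => ENNReal.ofReal (katoKernel d a)
      * l1LocUnifNorm ({x : Space d | R ≤ ‖x‖}.indicator W)) atTop (𝓝 0) := by
    have := ENNReal.Tendsto.const_mul hV (a := ENNReal.ofReal (katoKernel d a))
      (Or.inr ENNReal.ofReal_ne_top)
    rwa [mul_zero] at this
  filter_upwards [ENNReal.tendsto_nhds_zero.1 h3 (ε / 2) hε2, eventually_gt_atTop ρ] with R hR hRρ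
  intro x
  set WR := {x : Space d | R ≤ ‖x‖}.indicator W with hWR
  have hle : ∀ y, ‖WR y‖ₑ ≤ ‖Kᶜ.indicator W y‖ₑ := by
    intro y
    by_cases hy : R ≤ ‖y‖
    · have hyK : y ∈ Kᶜ := fun hyK => by
        have := hρ hyK
        rw [Metric.mem_closedBall, dist_zero_right] at this
        linarith
      rw [Set.indicator_of_mem hyK, hWR, Set.indicator_of_mem (by exact hy)]
    · rw [hWR, Set.indicator_of_notMem (by exact hy)]
      simp
  have hsub : Metric.closedBall x (1 / 2)
      ⊆ Metric.closedBall x a ∪ (Metric.closedBall x (1 / 2) \ Metric.closedBall x a) := by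
    intro y hy
    by_cases h : y ∈ Metric.closedBall x a
    · exact Or.inl h
    · exact Or.inr ⟨hy, h⟩
  calc ∫⁻ y in Metric.closedBall x (1 / 2), ENNReal.ofReal (katoKernel d ‖x - y‖) * ‖WR y‖ₑ
      ≤ ∫⁻ y in Metric.closedBall x a ∪ (Metric.closedBall x (1 / 2) \ Metric.closedBall x a),
          ENNReal.ofReal (katoKernel d ‖x - y‖) * ‖WR y‖ₑ := lintegral_mono_set hsub
    _ ≤ (∫⁻ y in Metric.closedBall x a, ENNReal.ofReal (katoKernel d ‖x - y‖) * ‖WR y‖ₑ)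
        + ∫⁻ y in Metric.closedBall x (1 / 2) \ Metric.closedBall x a,
          ENNReal.ofReal (katoKernel d ‖x - y‖) * ‖WR y‖ₑ := lintegral_union_le _ _ _
    _ ≤ ε / 2 + ε / 2 := by
        refine add_le_add ?_ ?_
        · refine le_trans (lintegral_mono fun y => ?_) ((le_iSup (fun x : Space d =>
            ∫⁻ y in Metric.closedBall x a, ENNReal.ofReal (katoKernel d ‖x - y‖)
              * ‖Kᶜ.indicator W y‖ₑ) x).trans ha1)
          gcongr
          exact hle y
        · refine le_trans ?_ hR
          calc ∫⁻ y in Metric.closedBall x (1 / 2) \ Metric.closedBall x a,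
                ENNReal.ofReal (katoKernel d ‖x - y‖) * ‖WR y‖ₑ
              ≤ ∫⁻ y in Metric.closedBall x (1 / 2) \ Metric.closedBall x a,
                ENNReal.ofReal (katoKernel d a) * ‖WR y‖ₑ := by
                refine setLIntegral_mono' (Metric.isClosed_closedBall.measurableSet.diff
                  Metric.isClosed_closedBall.measurableSet) fun y hy => ?_
                gcongr
                have h4 := hy.1
                have h5 := hy.2
                rw [Metric.mem_closedBall, dist_comm, dist_eq_norm] at h4 h5
                exact katoKernel_anti hd ha0 (not_le.1 h5).le (h4.trans (by norm_num))
            _ ≤ ∫⁻ y in Metric.closedBall x 1, ENNReal.ofReal (katoKernel d a) * ‖WR y‖ₑ :=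
                lintegral_mono_set (Set.sdiff_subset.trans
                  (Metric.closedBall_subset_closedBall (by norm_num)))
            _ = ENNReal.ofReal (katoKernel d a) * ∫⁻ y in Metric.closedBall x 1, ‖WR y‖ₑ :=
                lintegral_const_mul' _ _ ENNReal.ofReal_ne_top
            _ ≤ _ := by
                gcongr
                exact le_iSup (fun x : Space d => ∫⁻ y in Metric.closedBall x 1, ‖WR y‖ₑ) x
    _ = ε := ENNReal.add_halves ε

theorem exists_katoBound_tendsto (hd : 2 ≤ d) (hK : KatoClassOutsideCompact W)
    (hV : VanishesLocUnifL1 W) :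
    ∃ R₀ : ℝ, 0 < R₀ ∧ ∃ κ : ℝ → ℝ, Tendsto κ atTop (𝓝 0) ∧ ∀ R, R₀ ≤ R →
      0 < κ R ∧ KatoBound ({x : Space d | R ≤ ‖x‖}.indicator W) (ENNReal.ofReal (κ R)) := by
  set k : ℝ → ℝ≥0∞ := fun R => ⨆ x : Space d, ∫⁻ y in Metric.closedBall x (1 / 2),
    ENNReal.ofReal (katoKernel d ‖x - y‖) * ‖{x : Space d | R ≤ ‖x‖}.indicator W y‖ₑ with hk
  have hkt : Tendsto k atTop (𝓝 0) := ENNReal.tendsto_nhds_zero.2 fun ε hε =>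
    (tendsto_katoBound hd hK hV hε).mono fun R hR => iSup_le hR
  obtain ⟨R₁, hR₁⟩ := eventually_atTop.1 ((ENNReal.tendsto_nhds_zero.1 hkt) 1 one_pos)
  -- The term `exp (-R)` makes the bound strictly positive without spoiling the limit; `R₁` ensures
  -- that `k R` is finite.
  refine ⟨max R₁ 1, by positivity, fun R => (k R).toReal + Real.exp (-R), ?_, ?_⟩
  · have h1 := (ENNReal.tendsto_toReal ENNReal.zero_ne_top).comp hkt
    have h2 := h1.add (Real.tendsto_exp_neg_atTop_nhds_zero)
    simpa using h2
  · intro R hR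
    have hfin : k R ≠ ⊤ := ((hR₁ R ((le_max_left _ _).trans hR)).trans_lt ENNReal.one_lt_top).ne
    refine ⟨by positivity, fun x => ?_⟩
    refine (le_iSup (fun x : Space d => ∫⁻ y in Metric.closedBall x (1 / 2),
      ENNReal.ofReal (katoKernel d ‖x - y‖) * ‖{x : Space d | R ≤ ‖x‖}.indicator W y‖ₑ) x).trans ?_
    change k R ≤ _
    rw [← ENNReal.ofReal_toReal hfin]
    exact ENNReal.ofReal_le_ofReal (by linarith [Real.exp_pos (-R)])

/-- For `φ` supported outside the `R`-ball, `W` may be replaced by its restriction to that region,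
whose Kato bound is small. Taking absolute values gives integrability as well, which the form domain
and part (ii) require. -/
theorem exists_integral_abs_mul_normSq_le (hd : 2 ≤ d) (hW : LocallyIntegrable W volume)
    (hK : KatoClassOutsideCompact W) (hV : VanishesLocUnifL1 W) :
    ∃ R₀ : ℝ, 0 < R₀ ∧ ∃ β : ℝ → ℝ, Tendsto β atTop (𝓝 0) ∧ ∀ R, R₀ ≤ R → 0 < β R ∧
      ∀ A : Space d → Space d, LocL2 A → ∀ φ v, HasMagneticMomentum A φ v → SuppOutside R φ →
        Integrable (fun x => |W x| * ‖φ x‖ ^ 2) volume ∧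
        ∫ x, |W x| * ‖φ x‖ ^ 2 ≤ β R * (l2NormSq v + l2NormSq φ) := by
  obtain ⟨C, hC, hform⟩ := exists_lintegral_mul_normSq_le hd
  obtain ⟨R₀, hR₀, κ, hκ, hκR⟩ := exists_katoBound_tendsto hd hK hV
  refine ⟨R₀, hR₀, fun R => C * κ R, by simpa using hκ.const_mul C, fun R hR => ?_⟩
  obtain ⟨hκ0, hkb⟩ := hκR R hR
  refine ⟨by positivity, fun A hA φ v hφ hsupp => ?_⟩
  set S := {x : Space d | R ≤ ‖x‖} with hS
  have hSm : MeasurableSet S := (isClosed_le continuous_const continuous_norm).measurableSet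
  have hWR : LocallyIntegrable (fun x => |S.indicator W x|) volume :=
    locallyIntegrable_iff.2 fun _ hc =>
      ((hW.indicator hSm).integrableOn_isCompact hc).norm
  have hle := hform (fun x => |S.indicator W x|) (κ R) hκ0 hWR (fun x => abs_nonneg _)
    (hkb.mono_fun fun x => by simp) A hA φ v hφ
  have hae : ∀ᵐ x, |S.indicator W x| * ‖φ x‖ ^ 2 = |W x| * ‖φ x‖ ^ 2 := by
    filter_upwards [hsupp] with x hx
    by_cases h : R ≤ ‖x‖
    · rw [Set.indicator_of_mem (by exact h)]
    · rw [hx (not_le.1 h)]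
      simp
  have hle2 : ∫⁻ x, ENNReal.ofReal (|W x| * ‖φ x‖ ^ 2)
      ≤ ENNReal.ofReal (C * κ R * (l2NormSq v + l2NormSq φ)) := by
    refine le_trans (le_of_eq (lintegral_congr_ae ?_)) hle
    filter_upwards [hae] with x hx
    rw [hx]
  have hnn : ∀ x, 0 ≤ |W x| * ‖φ x‖ ^ 2 := fun x => by positivity
  have hm : AEStronglyMeasurable (fun x => |W x| * ‖φ x‖ ^ 2) volume :=
    hW.aestronglyMeasurable.norm.mul (hφ.memLp_fun.aestronglyMeasurable.norm.pow 2)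
  have hi : Integrable (fun x => |W x| * ‖φ x‖ ^ 2) volume := by
    refine ⟨hm, lt_of_le_of_lt (le_of_eq ?_) (hle2.trans_lt ENNReal.ofReal_lt_top)⟩
    exact lintegral_congr fun x => Real.enorm_of_nonneg (hnn x)
  refine ⟨hi, ?_⟩
  have hv0 : 0 ≤ l2NormSq v := integral_nonneg fun x => by positivity
  have hφ0 : 0 ≤ l2NormSq φ := integral_nonneg fun x => by positivity
  rw [← ENNReal.ofReal_le_ofReal_iff (by positivity),
    ofReal_integral_eq_lintegral_ofReal hi (Eventually.of_forall hnn)]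
  exact hle2

theorem vanishesAtInfinity (hd : 2 ≤ d) (hW : LocallyIntegrable W volume)
    (hK : KatoClassOutsideCompact W) (hV : VanishesLocUnifL1 W) {A : Space d → Space d}
    (hA : LocL2 A) : VanishesAtInfinity A W := by
  obtain ⟨R₀, hR₀, β, hβ, hmain⟩ := exists_integral_abs_mul_normSq_le hd hW hK hV
  refine ⟨R₀, hR₀, fun φ v hφ hs => ⟨hφ.memLp_fun, ?_⟩, β, β,
    fun R hR => ⟨(hmain R hR).1, (hmain R hR).1⟩, hβ, hβ, fun R hR φ v hφ hs => ?_⟩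
  · have hi := ((hmain R₀ le_rfl).2 A hA φ v hφ hs).1
    have hm : AEStronglyMeasurable (fun x => ((√|W x| : ℝ) : ℂ) * φ x) volume := by
      refine AEStronglyMeasurable.mul ?_ hφ.memLp_fun.aestronglyMeasurable
      exact (Complex.continuous_ofReal.comp (Real.continuous_sqrt.comp
        continuous_abs)).comp_aestronglyMeasurable hW.aestronglyMeasurable
    rw [memLp_two_iff_integrable_sq_norm hm]
    refine hi.congr (Eventually.of_forall fun x => ?_)
    simp only [norm_mul, mul_pow, Complex.norm_real, Real.norm_eq_abs, sq_abs]
    rw [Real.sq_sqrt (abs_nonneg _)]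
  · have h := ((hmain R hR).2 A hA φ v hφ hs).2
    unfold potentialForm
    refine (abs_integral_le_integral_abs).trans (le_trans (le_of_eq ?_) (h.trans (le_of_eq (by ring))))
    congr 1
    ext x
    rw [abs_mul, abs_of_nonneg (sq_nonneg ‖φ x‖)]

end KatoVanishing

/-! ### The quadratic form of a distribution -/

namespace KatoVanishing
open scoped ContDiff

variable {d : ℕ} {A S : Space d → Space d} {W : Space d → ℝ}

theorem HasMagneticMomentum.integrable_mul_test (hA : LocL2 A) {φ : Space d → ℂ}
    (hφ : MemLp φ 2 volume) (ψ : 𝓓((⊤ : Opens (Space d)), ℂ)) (j : Fin d) :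
    Integrable (fun x => φ x * (Complex.I * fderiv ℝ ψ x (basisVec j)
      - ((A x j : ℝ) : ℂ) * ψ x)) volume := by
  have i1 := TestFunction.integrable_mul (hφ.locallyIntegrable one_le_two)
    (continuous_fderiv_testFunction ψ (basisVec j))
    (hasCompactSupport_fderiv_testFunction ψ (basisVec j))
  have i2 := TestFunction.integrable_mul (hA.locallyIntegrable_mul j hφ)
    ψ.continuous ψ.hasCompactSupport
  refine ((i1.const_mul Complex.I).sub i2).congr (Eventually.of_forall fun x => ?_)
  simp only [Pi.sub_apply]
  ring

theorem HasMagneticMomentum.sub (hA : LocL2 A) {φ φ' : Space d → ℂ}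
    {v v' : Space d → EuclideanSpace ℂ (Fin d)} (h : HasMagneticMomentum A φ v)
    (h' : HasMagneticMomentum A φ' v') : HasMagneticMomentum A (φ - φ') (v - v') := by
  refine ⟨h.memLp_fun.sub h'.memLp_fun, h.memLp_momentum.sub h'.memLp_momentum, fun ψ j => ?_⟩
  have i1 := TestFunction.integrable_mul
    ((memLp_euclidean_apply h.memLp_momentum j).locallyIntegrable one_le_two)
    ψ.continuous ψ.hasCompactSupport
  have i2 := TestFunction.integrable_mul
    ((memLp_euclidean_apply h'.memLp_momentum j).locallyIntegrable one_le_two)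
    ψ.continuous ψ.hasCompactSupport
  have e1 := integral_sub (HasMagneticMomentum.integrable_mul_test hA h.memLp_fun ψ j)
    (HasMagneticMomentum.integrable_mul_test hA h'.memLp_fun ψ j)
  have e2 := integral_sub i1 i2
  simp only [Pi.sub_apply, PiLp.sub_apply, sub_mul]
  rw [e1, e2, h.weak_eq, h'.weak_eq]

/-- `(P - A) φ` is determined by `φ`. -/
theorem HasMagneticMomentum.unique {φ : Space d → ℂ}
    {v v' : Space d → EuclideanSpace ℂ (Fin d)} (h : HasMagneticMomentum A φ v)
    (h' : HasMagneticMomentum A φ v') : v =ᵐ[volume] v' := by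
  have hj : ∀ j : Fin d, ∀ᵐ x, v x j = v' x j := by
    intro j
    refine ae_eq_of_integral_contDiff_smul_eq
      ((memLp_euclidean_apply h.memLp_momentum j).locallyIntegrable one_le_two)
      ((memLp_euclidean_apply h'.memLp_momentum j).locallyIntegrable one_le_two) ?_
    intro g hg hgc
    let ψ : 𝓓((⊤ : Opens (Space d)), ℂ) :=
      { toFun := fun y => (g y : ℂ)
        contDiff' := Complex.ofRealCLM.contDiff.comp hg
        hasCompactSupport' := hgc.comp_left (g := fun r : ℝ => (r : ℂ)) (by simp)
        tsupport_subset' := fun _ _ => trivial }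
    have := (h.weak_eq ψ j).symm.trans (h'.weak_eq ψ j)
    simp only [Complex.real_smul]
    convert this using 2 <;> (ext x; rw [mul_comm]; rfl)
  filter_upwards [ae_all_iff.2 hj] with x hx
  ext j
  exact hx j

/-- The density of the quadratic form of `∇·S + W`. -/
noncomputable def formDensity (S : Space d → Space d) (W : Space d → ℝ) (φ : Space d → ℂ)
    (v : Space d → EuclideanSpace ℂ (Fin d)) (x : Space d) : ℝ :=
  (∑ j, 2 * (starRingEnd ℂ (φ x) * v x j).im * S x j) + W x * ‖φ x‖ ^ 2

open Classical in
/-- The quadratic form of `∇·S + W` on `𝒟(P - A)`. -/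
noncomputable def distForm (A S : Space d → Space d) (W : Space d → ℝ) (φ : Space d → ℂ) : ℝ :=
  if h : ∃ v, HasMagneticMomentum A φ v then ∫ x, formDensity S W φ h.choose x else 0

/-- By uniqueness of the weak momentum, the choice made in `distForm` is irrelevant. -/
theorem distForm_eq {φ : Space d → ℂ} {v : Space d → EuclideanSpace ℂ (Fin d)}
    (h : HasMagneticMomentum A φ v) : distForm A S W φ = ∫ x, formDensity S W φ v x := by
  have hex : ∃ v, HasMagneticMomentum A φ v := ⟨v, h⟩
  rw [distForm, dif_pos hex]
  refine integral_congr_ae ?_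
  filter_upwards [hex.choose_spec.unique h] with x hx
  simp only [formDensity, hx]

/-- Young's inequality with a free weight: different weights serve the smallness of the form and its
continuity. -/
theorem two_mul_abs_im_mul_le (z w : ℂ) (t : ℝ) {ε : ℝ} (hε : 0 < ε) :
    2 * |(starRingEnd ℂ z * w).im * t| ≤ ε * ‖w‖ ^ 2 + ε⁻¹ * (t ^ 2 * ‖z‖ ^ 2) := by
  have h1 : |(starRingEnd ℂ z * w).im * t| ≤ ‖w‖ * (|t| * ‖z‖) := by
    rw [abs_mul]
    have := Complex.abs_im_le_norm (starRingEnd ℂ z * w)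
    rw [norm_mul, RCLike.norm_conj] at this
    calc _ ≤ (‖z‖ * ‖w‖) * |t| := by gcongr
      _ = _ := by ring
  have h2 : 2 * (‖w‖ * (|t| * ‖z‖)) ≤ ε * ‖w‖ ^ 2 + ε⁻¹ * (|t| * ‖z‖) ^ 2 := by
    have h3 : 0 ≤ ε⁻¹ * (ε * ‖w‖ - |t| * ‖z‖) ^ 2 := by positivity
    have h4 : ε⁻¹ * (ε * ‖w‖ - |t| * ‖z‖) ^ 2
        = ε * ‖w‖ ^ 2 + ε⁻¹ * (|t| * ‖z‖) ^ 2 - 2 * (‖w‖ * (|t| * ‖z‖)) := by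
      field_simp
      ring
    linarith
  rw [mul_pow, sq_abs] at h2
  linarith

theorem abs_formDensity_le (φ : Space d → ℂ) (v : Space d → EuclideanSpace ℂ (Fin d)) (x : Space d)
    {ε : ℝ} (hε : 0 < ε) : |formDensity S W φ v x|
      ≤ ε * ‖v x‖ ^ 2 + ε⁻¹ * (|‖S x‖ ^ 2| * ‖φ x‖ ^ 2) + |W x| * ‖φ x‖ ^ 2 := by
  unfold formDensity
  refine (abs_add_le _ _).trans (add_le_add ?_ ?_)
  · rw [abs_of_nonneg (sq_nonneg ‖S x‖), EuclideanSpace.norm_sq_eq, EuclideanSpace.real_norm_sq_eq,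
      Finset.sum_mul, Finset.mul_sum, Finset.mul_sum, ← Finset.sum_add_distrib]
    refine (Finset.abs_sum_le_sum_abs _ _).trans (Finset.sum_le_sum fun j _ => ?_)
    have := two_mul_abs_im_mul_le (φ x) (v x j) (S x j) hε
    rwa [mul_assoc, abs_mul, abs_two]
  · rw [abs_mul, abs_of_nonneg (sq_nonneg ‖φ x‖)]

/-- A majorant of `formDensity`. -/
noncomputable def formMajorant (S : Space d → Space d) (W : Space d → ℝ) (φ : Space d → ℂ)
    (v : Space d → EuclideanSpace ℂ (Fin d)) (x : Space d) : ℝ :=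
  ‖v x‖ ^ 2 + |‖S x‖ ^ 2| * ‖φ x‖ ^ 2 + |W x| * ‖φ x‖ ^ 2

/-- The density is quadratic in `(φ, v)`, so a difference consists of cross terms and a term
quadratic in the increment. Young's inequality puts `ε` on the fixed state and `ε⁻¹` on the
increment, which gives continuity after choosing `ε` and only then `n`. -/
theorem abs_formDensity_sub_le (φ φ' : Space d → ℂ) (v v' : Space d → EuclideanSpace ℂ (Fin d))
    (x : Space d) {ε : ℝ} (hε : 0 < ε) :
    |formDensity S W φ' v' x - formDensity S W φ v x|
      ≤ (1 + ε⁻¹) * formMajorant S W (φ' - φ) (v' - v) x + ε * formMajorant S W φ v x := by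
  set h : ℂ := φ' x - φ x with hh
  have hφ' : φ' x = φ x + h := by rw [hh]; ring
  have e1 : formDensity S W φ' v' x - formDensity S W φ v x
      = (∑ j, 2 * ((starRingEnd ℂ (φ x) * (v' x j - v x j)).im
          + (starRingEnd ℂ h * v x j).im + (starRingEnd ℂ h * (v' x j - v x j)).im) * S x j)
        + W x * (‖φ' x‖ ^ 2 - ‖φ x‖ ^ 2) := by
    unfold formDensity
    rw [add_sub_add_comm, ← Finset.sum_sub_distrib, ← mul_sub]
    congr 1
    refine Finset.sum_congr rfl fun j _ => ?_
    rw [hφ', ← sub_mul, ← mul_sub, ← Complex.sub_im, ← Complex.add_im, ← Complex.add_im, map_add]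
    ring_nf
  have hW : |W x * (‖φ' x‖ ^ 2 - ‖φ x‖ ^ 2)|
      ≤ (1 + ε⁻¹) * (|W x| * ‖h‖ ^ 2) + ε * (|W x| * ‖φ x‖ ^ 2) := by
    rw [abs_mul]
    have h1 : |‖φ' x‖ - ‖φ x‖| ≤ ‖h‖ := abs_norm_sub_norm_le _ _
    have h2 : ‖φ' x‖ + ‖φ x‖ ≤ 2 * ‖φ x‖ + ‖h‖ := by linarith [le_abs_self (‖φ' x‖ - ‖φ x‖)]
    have h3 : |‖φ' x‖ ^ 2 - ‖φ x‖ ^ 2| ≤ ‖h‖ * (2 * ‖φ x‖ + ‖h‖) := by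
      rw [sq_sub_sq, abs_mul, mul_comm, abs_of_nonneg (by positivity : 0 ≤ ‖φ' x‖ + ‖φ x‖)]
      exact mul_le_mul h1 h2 (by positivity) (norm_nonneg _)
    have h4 : 2 * ‖h‖ * ‖φ x‖ ≤ ε⁻¹ * ‖h‖ ^ 2 + ε * ‖φ x‖ ^ 2 := by
      have h5 : 0 ≤ ε⁻¹ * (ε * ‖φ x‖ - ‖h‖) ^ 2 := by positivity
      have h6 : ε⁻¹ * (ε * ‖φ x‖ - ‖h‖) ^ 2
          = ε⁻¹ * ‖h‖ ^ 2 + ε * ‖φ x‖ ^ 2 - 2 * ‖h‖ * ‖φ x‖ := by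
        field_simp
        ring
      linarith
    calc |W x| * |‖φ' x‖ ^ 2 - ‖φ x‖ ^ 2|
        ≤ |W x| * ((1 + ε⁻¹) * ‖h‖ ^ 2 + ε * ‖φ x‖ ^ 2) := by
          gcongr
          linarith
      _ = _ := by ring
  have hj : ∀ j, |2 * ((starRingEnd ℂ (φ x) * (v' x j - v x j)).im
          + (starRingEnd ℂ h * v x j).im + (starRingEnd ℂ h * (v' x j - v x j)).im) * S x j|
      ≤ (1 + ε⁻¹) * (‖v' x j - v x j‖ ^ 2 + S x j ^ 2 * ‖h‖ ^ 2)
        + ε * (‖v x j‖ ^ 2 + S x j ^ 2 * ‖φ x‖ ^ 2) := by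
    intro j
    -- The weight is inverted here because the increment sits in `v`; in `h2` it sits in `φ`.
    have h1 := two_mul_abs_im_mul_le (φ x) (v' x j - v x j) (S x j) (inv_pos.2 hε)
    have h2 := two_mul_abs_im_mul_le h (v x j) (S x j) hε
    have h3 := two_mul_abs_im_mul_le h (v' x j - v x j) (S x j) one_pos
    rw [inv_inv] at h1
    rw [inv_one] at h3
    rw [mul_assoc, abs_mul, abs_two, add_mul, add_mul]
    have h4 := abs_add_three ((starRingEnd ℂ (φ x) * (v' x j - v x j)).im * S x j)
      ((starRingEnd ℂ h * v x j).im * S x j) ((starRingEnd ℂ h * (v' x j - v x j)).im * S x j)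
    linarith
  have hS : |∑ j, 2 * ((starRingEnd ℂ (φ x) * (v' x j - v x j)).im
          + (starRingEnd ℂ h * v x j).im + (starRingEnd ℂ h * (v' x j - v x j)).im) * S x j|
      ≤ (1 + ε⁻¹) * (‖v' x - v x‖ ^ 2 + ‖S x‖ ^ 2 * ‖h‖ ^ 2)
        + ε * (‖v x‖ ^ 2 + ‖S x‖ ^ 2 * ‖φ x‖ ^ 2) := by
    rw [EuclideanSpace.norm_sq_eq (v' x - v x), EuclideanSpace.norm_sq_eq (v x),
      EuclideanSpace.real_norm_sq_eq, Finset.sum_mul, Finset.sum_mul, ← Finset.sum_add_distrib,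
      ← Finset.sum_add_distrib, Finset.mul_sum, Finset.mul_sum, ← Finset.sum_add_distrib]
    exact (Finset.abs_sum_le_sum_abs _ _).trans (Finset.sum_le_sum fun j _ => hj j)
  rw [e1]
  refine (abs_add_le _ _).trans ((add_le_add hS hW).trans (le_of_eq ?_))
  simp only [formMajorant, Pi.sub_apply, abs_of_nonneg (sq_nonneg ‖S x‖), ← hh]
  ring

end KatoVanishing

/-! ### Distributions vanishing at infinity -/

namespace KatoVanishing
open scoped ContDiff

variable {d : ℕ} {A S : Space d → Space d} {W : Space d → ℝ}

theorem LocL2.locallyIntegrable_normSq (hS : LocL2 S) :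
    LocallyIntegrable (fun x => ‖S x‖ ^ 2) volume :=
  locallyIntegrable_iff.2 fun K hK => (hS K hK).integrable_norm_pow two_ne_zero

theorem aestronglyMeasurable_formDensity (hS : LocL2 S) (hW : LocallyIntegrable W volume)
    {φ : Space d → ℂ} {v : Space d → EuclideanSpace ℂ (Fin d)} (h : HasMagneticMomentum A φ v) :
    AEStronglyMeasurable (formDensity S W φ v) volume := by
  refine AEStronglyMeasurable.add ?_ (hW.aestronglyMeasurable.mul
    (h.memLp_fun.aestronglyMeasurable.norm.pow 2))
  refine Finset.aestronglyMeasurable_fun_sum _ fun j _ => ?_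
  exact (integrable_im_mul h.memLp_fun
    (memLp_euclidean_apply h.memLp_momentum j)).aestronglyMeasurable.mul
    (hS.locallyIntegrable_apply j).aestronglyMeasurable

theorem integrable_formMajorant {φ : Space d → ℂ} {v : Space d → EuclideanSpace ℂ (Fin d)}
    (h : HasMagneticMomentum A φ v)
    (hS2 : Integrable (fun x => |‖S x‖ ^ 2| * ‖φ x‖ ^ 2) volume)
    (hWi : Integrable (fun x => |W x| * ‖φ x‖ ^ 2) volume) :
    Integrable (formMajorant S W φ v) volume :=
  ((h.memLp_momentum.integrable_norm_pow two_ne_zero).add hS2).add hWi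

theorem integrable_formDensity {φ : Space d → ℂ} {v : Space d → EuclideanSpace ℂ (Fin d)}
    (h : HasMagneticMomentum A φ v)
    (hS2 : Integrable (fun x => |‖S x‖ ^ 2| * ‖φ x‖ ^ 2) volume)
    (hWi : Integrable (fun x => |W x| * ‖φ x‖ ^ 2) volume)
    (hS : LocL2 S) (hW : LocallyIntegrable W volume) :
    Integrable (formDensity S W φ v) volume := by
  refine (integrable_formMajorant h hS2 hWi).mono' (aestronglyMeasurable_formDensity hS hW h)
    (Eventually.of_forall fun x => ?_)
  have := abs_formDensity_le (S := S) (W := W) φ v x one_pos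
  simpa [formMajorant] using this

theorem integral_formMajorant {φ : Space d → ℂ} {v : Space d → EuclideanSpace ℂ (Fin d)}
    (h : HasMagneticMomentum A φ v)
    (hS2 : Integrable (fun x => |‖S x‖ ^ 2| * ‖φ x‖ ^ 2) volume)
    (hWi : Integrable (fun x => |W x| * ‖φ x‖ ^ 2) volume) :
    ∫ x, formMajorant S W φ v x
    = l2NormSq v + (∫ x, |‖S x‖ ^ 2| * ‖φ x‖ ^ 2) + ∫ x, |W x| * ‖φ x‖ ^ 2 := by
  have hv : Integrable (fun x => ‖v x‖ ^ 2) volume :=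
    h.memLp_momentum.integrable_norm_pow two_ne_zero
  have e1 := integral_add (hv.add hS2) hWi
  have e2 := integral_add hv hS2
  simp only [Pi.add_apply] at e1
  unfold formMajorant l2NormSq
  rw [e1, e2]

theorem abs_distForm_le {φ : Space d → ℂ} {v : Space d → EuclideanSpace ℂ (Fin d)}
    (h : HasMagneticMomentum A φ v)
    (hS2 : Integrable (fun x => |‖S x‖ ^ 2| * ‖φ x‖ ^ 2) volume)
    (hWi : Integrable (fun x => |W x| * ‖φ x‖ ^ 2) volume)
    {ε : ℝ} (hε : 0 < ε) :
    |distForm A S W φ| ≤ ε * l2NormSq v + ε⁻¹ * (∫ x, |‖S x‖ ^ 2| * ‖φ x‖ ^ 2)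
      + ∫ x, |W x| * ‖φ x‖ ^ 2 := by
  have hv : Integrable (fun x => ‖v x‖ ^ 2) volume :=
    h.memLp_momentum.integrable_norm_pow two_ne_zero
  have i12 : Integrable (fun x => ε * ‖v x‖ ^ 2 + ε⁻¹ * (|‖S x‖ ^ 2| * ‖φ x‖ ^ 2)) volume :=
    (hv.const_mul ε).add (hS2.const_mul ε⁻¹)
  rw [distForm_eq h]
  have i123 : Integrable (fun x => ε * ‖v x‖ ^ 2 + ε⁻¹ * (|‖S x‖ ^ 2| * ‖φ x‖ ^ 2)
      + |W x| * ‖φ x‖ ^ 2) volume := i12.add hWi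
  refine (norm_integral_le_of_norm_le (f := formDensity S W φ v) i123
    (Eventually.of_forall fun x => abs_formDensity_le (S := S) (W := W) φ v x hε)).trans
    (le_of_eq ?_)
  rw [integral_add i12 hWi, integral_add (hv.const_mul ε) (hS2.const_mul ε⁻¹), integral_const_mul,
    integral_const_mul]
  rfl

/-- `Aφ` is square integrable because `φ` is bounded with compact support and `A` is in `L²_loc`. -/
theorem hasMagneticMomentum_testFunction (hA : LocL2 A) (φ : 𝓓((⊤ : Opens (Space d)), ℂ)) :
    HasMagneticMomentum A φ (fun x => WithLp.toLp 2 fun j =>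
      -Complex.I * fderiv ℝ φ x (basisVec j) - ((A x j : ℝ) : ℂ) * φ x) := by
  have hφ : MemLp φ 2 volume := φ.continuous.memLp_of_hasCompactSupport φ.hasCompactSupport
  refine ⟨hφ, MemLp.of_eval_piLp fun j => ?_, fun ψ j => ?_⟩
  · refine MemLp.sub (MemLp.const_mul ((continuous_fderiv_testFunction φ
      _).memLp_of_hasCompactSupport (hasCompactSupport_fderiv_testFunction φ _)) _) ?_
    have hK := φ.hasCompactSupport.isCompact
    have h1 : MemLp (fun x => ((A x j : ℝ) : ℂ) * φ x) 2 (volume.restrict (tsupport φ)) :=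
      (φ.memLp_top.restrict (tsupport φ)).mul (hA.memLp_apply j hK).ofReal
    rw [← memLp_indicator_iff_restrict (isClosed_tsupport φ).measurableSet] at h1
    refine h1.ae_eq (Eventually.of_forall fun x => ?_)
    by_cases hx : x ∈ tsupport φ
    · rw [Set.indicator_of_mem hx]
    · rw [Set.indicator_of_notMem hx]
      simp only
      rw [image_eq_zero_of_notMem_tsupport hx, mul_zero]
  · have hd : ∀ χ : 𝓓((⊤ : Opens (Space d)), ℂ), Differentiable ℝ χ := fun χ =>
      χ.contDiff.differentiable (by simp)
    have i1 : Integrable (fun x => fderiv ℝ φ x (basisVec j) * ψ x) volume :=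
      ((continuous_fderiv_testFunction φ _).mul ψ.continuous).integrable_of_hasCompactSupport
        ψ.hasCompactSupport.mul_left
    have i2 : Integrable (fun x => φ x * fderiv ℝ ψ x (basisVec j)) volume :=
      (φ.continuous.mul (continuous_fderiv_testFunction ψ _)).integrable_of_hasCompactSupport
        φ.hasCompactSupport.mul_right
    have i3 : Integrable (fun x => φ x * ψ x) volume :=
      (φ.continuous.mul ψ.continuous).integrable_of_hasCompactSupport
        φ.hasCompactSupport.mul_right
    have i4 := TestFunction.integrable_mul (hA.locallyIntegrable_mul j hφ)
      ψ.continuous ψ.hasCompactSupport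
    have hp := integral_mul_fderiv_eq_neg_fderiv_mul_of_integrable (𝕜 := ℂ) i1 i2 i3
      (fun x _ => (hd φ).differentiableAt) (fun x _ => (hd ψ).differentiableAt)
    have e1 : ∫ x, φ x * (Complex.I * fderiv ℝ ψ x (basisVec j) - ((A x j : ℝ) : ℂ) * ψ x)
        = Complex.I * (∫ x, φ x * fderiv ℝ ψ x (basisVec j))
          - ∫ x, ((A x j : ℝ) : ℂ) * φ x * ψ x := by
      rw [← integral_const_mul, ← integral_sub (i2.const_mul _) i4]
      congr 1
      ext x
      ring
    have e2 : ∫ x, (-Complex.I * fderiv ℝ φ x (basisVec j) - ((A x j : ℝ) : ℂ) * φ x) * ψ x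
        = -Complex.I * (∫ x, fderiv ℝ φ x (basisVec j) * ψ x)
          - ∫ x, ((A x j : ℝ) : ℂ) * φ x * ψ x := by
      rw [← integral_const_mul, ← integral_sub (i1.const_mul _) i4]
      congr 1
      ext x
      ring
    simp only
    rw [e1, e2, hp]
    ring

theorem distOf_apply {f : Space d → ℝ} (hf : LocallyIntegrable f volume)
    (ψ : 𝓓((⊤ : Opens (Space d)), ℝ)) : distOf f ψ = ∫ x, f x * ψ x := by
  have h := TestFunction.integralAgainstBilinCLM_eq_integral (𝕜 := ℝ) (n := ⊤)
    (B := ContinuousLinearMap.mul ℝ ℝ) (μ := volume) (φ := f) (Ω := (⊤ : Opens (Space d)))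
    (hf.locallyIntegrableOn _) (f := ψ)
  refine h.trans ?_
  congr 1
  ext x
  simp [mul_comm]

theorem fderiv_absSq (φ : 𝓓((⊤ : Opens (Space d)), ℂ)) (x e : Space d) :
    fderiv ℝ (absSq φ) x e = 2 * (starRingEnd ℂ (φ x) * fderiv ℝ φ x e).re := by
  have h1 : HasFDerivAt (φ : Space d → ℂ) (fderiv ℝ φ x) x :=
    ((φ.contDiff.differentiable (by simp)).differentiableAt).hasFDerivAt
  have h2 : HasFDerivAt (absSq φ : Space d → ℝ) _ x := h1.norm_sq
  rw [h2.fderiv]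
  simp [Complex.inner, mul_comm]
  ring

theorem distDiv_apply (hS : LocL2 S) (ψ : 𝓓((⊤ : Opens (Space d)), ℝ)) :
    distDiv S ψ = ∑ j, -∫ x, S x j * fderiv ℝ ψ x (basisVec j) := by
  unfold distDiv
  rw [_root_.sum_apply]
  refine Finset.sum_congr rfl fun j _ => ?_
  rw [Distribution.lineDerivOp_apply_apply, map_neg, distOf_apply (hS.locallyIntegrable_apply j)]
  rfl

/-- The divergence contributes `-∫ S_j ∂_j|φ|²`, and `-∂_j|φ|² = 2 Im(conj φ v_j)` holds pointwise
for smooth `φ`, with the contribution of `A` cancelling. -/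
theorem distForm_testFunction (hA : LocL2 A) (hS : LocL2 S) (hW : LocallyIntegrable W volume)
    (φ : 𝓓((⊤ : Opens (Space d)), ℂ)) :
    distForm A S W φ = (distDiv S + distOf W) (absSq φ) := by
  rw [distForm_eq (hasMagneticMomentum_testFunction hA φ), _root_.add_apply, distDiv_apply hS,
    distOf_apply hW]
  have hc : ∀ j : Fin d, Continuous fun x => fderiv ℝ (absSq φ) x (basisVec j) := fun j =>
    ((absSq φ).contDiff.continuous_fderiv (by simp)).clm_apply continuous_const
  have hcs : ∀ j : Fin d, HasCompactSupport fun x => fderiv ℝ (absSq φ) x (basisVec j) := fun j =>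
    ((absSq φ).hasCompactSupport.fderiv ℝ).comp_left
      (g := fun L : Space d →L[ℝ] ℝ => L (basisVec j)) (by simp)
  have i1 : ∀ j : Fin d, Integrable (fun x => S x j * fderiv ℝ (absSq φ) x (basisVec j)) volume := by
    intro j
    have := (hS.locallyIntegrable_apply j).integrable_smul_left_of_hasCompactSupport (hc j) (hcs j)
    simpa [mul_comm] using this
  have i1n : ∀ j : Fin d,
      Integrable (fun x => -(S x j * fderiv ℝ (absSq φ) x (basisVec j))) volume :=
    fun j => (i1 j).neg
  have i2 : Integrable (fun x => W x * absSq φ x) volume := by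
    have := hW.integrable_smul_left_of_hasCompactSupport (absSq φ).continuous
      (absSq φ).hasCompactSupport
    simpa [mul_comm] using this
  simp_rw [← integral_neg]
  rw [← integral_finsetSum _ fun j _ => i1n j,
    ← integral_add (integrable_finsetSum _ fun j _ => i1n j) i2]
  congr 1
  ext x
  unfold formDensity
  congr 1
  refine Finset.sum_congr rfl fun j _ => ?_
  rw [fderiv_absSq]
  simp [Complex.mul_re, Complex.mul_im]
  ring

/-- Both `Σ²` and `W` are form bounded with small constants by the estimate behind (i). This makes
the density integrable on the whole domain beyond `R₀`, and gives both continuity and decay. -/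
theorem distributionVanishesAtInfinity (hd : 2 ≤ d) (hS : LocL2 S)
    (hW : LocallyIntegrable W volume) (hSK : KatoClassOutsideCompact fun x => ‖S x‖ ^ 2)
    (hSV : VanishesLocUnifL1 fun x => ‖S x‖ ^ 2) (hWK : KatoClassOutsideCompact W)
    (hWV : VanishesLocUnifL1 W) (hA : LocL2 A) :
    DistributionVanishesAtInfinity A (distDiv S + distOf W) := by
  obtain ⟨R₁, hR₁, β₁, hβ₁, h1⟩ :=
    exists_integral_abs_mul_normSq_le hd hS.locallyIntegrable_normSq hSK hSV
  obtain ⟨R₂, hR₂, β₂, hβ₂, h2⟩ := exists_integral_abs_mul_normSq_le hd hW hWK hWV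
  set R₀ := max R₁ R₂ with hR₀
  have hle1 : ∀ R, R₀ ≤ R → R₁ ≤ R := fun R hR => (le_max_left _ _).trans hR
  have hle2 : ∀ R, R₀ ≤ R → R₂ ≤ R := fun R hR => (le_max_right _ _).trans hR
  refine ⟨R₀, by positivity, distForm A S W, fun φ _ => distForm_testFunction hA hS hW φ,
    -- With weight `√β₁` on the momentum, the `Σ²` term costs `β₁/√β₁ = √β₁` times `‖v‖² + ‖φ‖²`.
    -- The momentum coefficient collects `√β₁` twice.
    ?_, fun R => 2 * √(β₁ R) + β₂ R, fun R => √(β₁ R) + β₂ R, fun R hR => ?_, ?_, ?_, ?_⟩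
  · intro φ v φs vs hφ hs hφs hss hφt hvt
    have a1 := ((h1 R₀ (hle1 _ le_rfl)).2 A hA φ v hφ hs).1
    have a2 := ((h2 R₀ (hle2 _ le_rfl)).2 A hA φ v hφ hs).1
    have b1 := fun n => ((h1 R₀ (hle1 _ le_rfl)).2 A hA _ _ (hφs n) (hss n)).1
    have b2 := fun n => ((h2 R₀ (hle2 _ le_rfl)).2 A hA _ _ (hφs n) (hss n)).1
    have hsub := fun n => (hφs n).sub hA hφ
    have hsupp : ∀ n, SuppOutside R₀ (φs n - φ) := fun n => by
      filter_upwards [hss n, hs] with x hx1 hx2 hx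
      rw [Pi.sub_apply, hx1 hx, hx2 hx, sub_zero]
    have c1 := fun n => (h1 R₀ (hle1 _ le_rfl)).2 A hA _ _ (hsub n) (hsupp n)
    have c2 := fun n => (h2 R₀ (hle2 _ le_rfl)).2 A hA _ _ (hsub n) (hsupp n)
    have hMi := integrable_formMajorant hφ a1 a2
    have hMni := fun n => integrable_formMajorant (hsub n) (c1 n).1 (c2 n).1
    set m : ℕ → ℝ := fun n => ∫ x, formMajorant S W (φs n - φ) (vs n - v) x with hm
    set M : ℝ := ∫ x, formMajorant S W φ v x with hM
    have hM0 : 0 ≤ M := integral_nonneg fun x => by unfold formMajorant; positivity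
    have hm0 : ∀ n, 0 ≤ m n := fun n => integral_nonneg fun x => by unfold formMajorant; positivity
    have hmt : Tendsto m atTop (𝓝 0) := by
      have hub : Tendsto (fun n => l2NormSq (vs n - v)
          + β₁ R₀ * (l2NormSq (vs n - v) + l2NormSq (φs n - φ))
          + β₂ R₀ * (l2NormSq (vs n - v) + l2NormSq (φs n - φ))) atTop (𝓝 0) := by
        have := (hvt.add ((hvt.add hφt).const_mul (β₁ R₀))).add
          ((hvt.add hφt).const_mul (β₂ R₀))
        simpa using this
      refine squeeze_zero hm0 (fun n => ?_) hub
      simp only [hm]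
      rw [integral_formMajorant (hsub n) (c1 n).1 (c2 n).1]
      exact add_le_add (add_le_add le_rfl (c1 n).2) (c2 n).2
    have hdiff : ∀ n, ∀ ε : ℝ, 0 < ε → |distForm A S W (φs n) - distForm A S W φ|
        ≤ (1 + ε⁻¹) * m n + ε * M := by
      intro n ε hε
      rw [distForm_eq (hφs n), distForm_eq hφ, ← integral_sub
        (integrable_formDensity (hφs n) (b1 n) (b2 n) hS hW)
        (integrable_formDensity hφ a1 a2 hS hW)]
      have hi : Integrable (fun x => (1 + ε⁻¹) * formMajorant S W (φs n - φ) (vs n - v) x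
          + ε * formMajorant S W φ v x) volume :=
        ((hMni n).const_mul (1 + ε⁻¹)).add (hMi.const_mul ε)
      refine (norm_integral_le_of_norm_le
        (f := fun x => formDensity S W (φs n) (vs n) x - formDensity S W φ v x) hi (Eventually.of_forall fun x =>
        abs_formDensity_sub_le (S := S) (W := W) φ (φs n) v (vs n) x hε)).trans (le_of_eq ?_)
      rw [integral_add ((hMni n).const_mul (1 + ε⁻¹)) (hMi.const_mul ε), integral_const_mul, integral_const_mul]
    rw [Metric.tendsto_atTop']
    intro e he
    -- `M + 1` instead of `M` covers the case `M = 0`.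
    set ε : ℝ := e / (2 * (M + 1)) with hε
    have hε0 : 0 < ε := by positivity
    have hεM : ε * M < e / 2 := by
      have : ε * (M + 1) = e / 2 := by rw [hε]; field_simp
      nlinarith
    have hlim : Tendsto (fun n => (1 + ε⁻¹) * m n) atTop (𝓝 0) := by
      simpa using hmt.const_mul (1 + ε⁻¹)
    obtain ⟨N, hN⟩ := eventually_atTop.1 (hlim.eventually (gt_mem_nhds (half_pos he)))
    refine ⟨N, fun n hn => ?_⟩
    rw [Real.dist_eq]
    have := hdiff n ε hε0
    have := hN n hn.le
    linarith
  · have p1 := (h1 R (hle1 R hR)).1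
    have p2 := (h2 R (hle2 R hR)).1
    constructor <;> positivity
  · have := (((Real.continuous_sqrt.tendsto 0).comp hβ₁).const_mul 2).add hβ₂
    simpa using this
  · have := ((Real.continuous_sqrt.tendsto 0).comp hβ₁).add hβ₂
    simpa using this
  · intro R hR φ v hφ hs
    obtain ⟨p1, q1⟩ := h1 R (hle1 R hR)
    obtain ⟨p2, q2⟩ := h2 R (hle2 R hR)
    obtain ⟨i1, b1⟩ := q1 A hA φ v hφ hs
    obtain ⟨i2, b2⟩ := q2 A hA φ v hφ hs
    have hsq : 0 < √(β₁ R) := Real.sqrt_pos.2 p1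
    refine (abs_distForm_le hφ i1 i2 hsq).trans ?_
    have e1 : (√(β₁ R))⁻¹ * (β₁ R * (l2NormSq v + l2NormSq φ))
        = √(β₁ R) * (l2NormSq v + l2NormSq φ) := by
      nth_rewrite 2 [← Real.mul_self_sqrt p1.le]
      field_simp
    have e2 : (√(β₁ R))⁻¹ * (∫ x, |‖S x‖ ^ 2| * ‖φ x‖ ^ 2)
        ≤ (√(β₁ R))⁻¹ * (β₁ R * (l2NormSq v + l2NormSq φ)) :=
      mul_le_mul_of_nonneg_left b1 (by positivity)
    rw [e1] at e2
    linarith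

theorem locL2_zero : LocL2 (fun _ : Space d => (0 : Space d)) := fun _ _ => MemLp.zero

end KatoVanishing

open KatoVanishing in
theorem proposition5 (d : ℕ) (hd : 2 ≤ d) :
    (∀ W : Space d → ℝ, LocallyIntegrable W volume →
      KatoClassOutsideCompact W → VanishesLocUnifL1 W →
        VanishesAtInfinity (fun _ => 0) W ∧
        ∀ A : Space d → Space d, LocL2 A → VanishesAtInfinity A W) ∧
    (∀ (S : Space d → Space d) (W : Space d → ℝ) (V : 𝓓'((⊤ : Opens (Space d)), ℝ)),
      LocL2 S → LocallyIntegrable W volume → V = distDiv S + distOf W →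
      KatoClassOutsideCompact (fun x => ‖S x‖ ^ 2) →
      VanishesLocUnifL1 (fun x => ‖S x‖ ^ 2) →
      KatoClassOutsideCompact W → VanishesLocUnifL1 W →
        DistributionVanishesAtInfinity (fun _ => 0) V ∧
        ∀ A : Space d → Space d, LocL2 A → DistributionVanishesAtInfinity A V) := by
  refine ⟨fun W hW hK hV => ⟨vanishesAtInfinity hd hW hK hV locL2_zero,
    fun A hA => vanishesAtInfinity hd hW hK hV hA⟩, ?_⟩
  rintro S W V hS hW rfl hSK hSV hWK hWV
  exact ⟨distributionVanishesAtInfinity hd hS hW hSK hSV hWK hWV locL2_zero,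
    fun A hA => distributionVanishesAtInfinity hd hS hW hSK hSV hWK hWV hA⟩
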